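/- Consider $N=m_1+m_2$ bosonic modes on $L^2(\mathbb{R}^N)$ with quadratures $R=(q_1,\dots,q_N,p_1,\dots,p_N)$, $q_j=x_j$, $p_j=-i\partial_j$, $[q_j,p_k]=i\delta_{jk}$, and Hamiltonian $H=\frac12\sum_{j=1}^N(q_j^2+p_j^2)$. A pure state $\rho=|\psi\rangle\langle\psi|$, $\|\psi\|=1$, is Gaussian if its characteristic function has the form $\operatorname{Tr}(\rho\, e^{i\xi\cdot R})=\exp\!\big(i\,\xi\cdot d-\tfrac14\,\xi^{T}C\,\xi\big)$, $\xi\in\mathbb{R}^{2N}$, with a real vector $d$ and a real matrix $C$; its covariance matrix is $\Sigma_{kl}=\langle R_kR_l+R_lR_k\rangle-2\langle R_k\rangle\langle R_l\rangle$. A unitary $U$ is Gaussian if $U^\dagger RU=SR+s$ with $S$ a real symplectic matrix and $s\in\mathbb{R}^{2N}$, in the sense that $U^\dagger e^{i\xi\cdot R}U=e^{i\xi\cdot(SR+s)}$ for all $\xi$. Let the modes be bipartitioned into $\mathcal{A}_1$ ($m_1$ modes) and $\mathcal{A}_2$ ($m_2$ modes), and put $$\mathcal{E}_G(\rho)=\operatorname{Tr}(\rho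 H)-\min_{U}\operatorname{Tr}(U\rho U^\dagger H),\qquad \mathcal{E}_{2\text{-loc}}^{\mathcal{A}_1|\mathcal{A}_2}(\rho)=\operatorname{Tr}(\rho H)-\min_{U_1\otimes U_2}\operatorname{Tr}\big((U_1\otimes U_2)\rho(U_1\otimes U_2)^\dagger H\big),$$ where $U$ runs over the Gaussian unitaries of all $N$ modes and $U_i$ over the Gaussian unitaries of the modes in $\mathcal{A}_i$. The 2-local ergotropic gap is $\delta^{\mathcal{A}_1|\mathcal{A}_2}_{2\text{-loc}}(\rho)=\mathcal{E}_G(\rho)-\mathcal{E}_{2\text{-loc}}^{\mathcal{A}_1|\mathcal{A}_2}(\rho)$. The symplectic eigenvalues of a real symmetric positive definite $2m\times 2m$ matrix $C$ are the numbers $\nu_1,\dots,\nu_m>0$ (with multiplicity) such that $SCS^{T}=\operatorname{diag}(\nu_1,\dots,\nu_m,\nu_1,\dots,\nu_m)$ for some symplectic $S$ (coordinates ordered as $q_1,\dots,q_m,p_1,\dots,p_m$). Lemma. Let $\rho$ be a pure Gaussian state of $m_1+m_2$ modes with $m_1\le m_2$. Then $\operatorname{Tr}(\rho H)$ is finite,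 both minima are attained, the reduced covariance matrix of $\mathcal{A}_1$ (the block of $\Sigma$ belonging to the quadratures of $\mathcal{A}_1$) has symplectic eigenvalues $\nu_1^{\mathcal{A}_1},\dots,\nu_{m_1}^{\mathcal{A}_1}$, and $$\delta^{\mathcal{A}_1|\mathcal{A}_2}_{2\text{-loc}}(\rho)=\sum_{i=1}^{m_1}\big(\nu_i^{\mathcal{A}_1}-1\big).$$ -/

import Mathlib

open MeasureTheory Matrix
open scoped ENNReal

noncomputable section

namespace CV

/-- The Hilbert space `L²(ℝ^ι)` of a system of bosonic modes labelled by `ι`. -/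
abbrev Hilb (ι : Type*) [Fintype ι] : Type _ :=
  Lp ℂ 2 (volume : Measure (ι → ℝ))

/-- Vectors of the phase space of the modes `ι`: the coordinate `Sum.inl i` belongs to the
position `q_i`, the coordinate `Sum.inr i` to the momentum `p_i`. -/
abbrev Phase (ι : Type*) : Type _ := ι ⊕ ι → ℝ

section OneSystem

variable {ι : Type*} [Fintype ι]

/-- The position part of a phase space vector. -/
def posPart (ξ : Phase ι) : ι → ℝ := fun i => ξ (Sum.inl i)

/-- The momentum part of a phase space vector. -/
def momPart (ξ : Phase ι) : ι → ℝ := fun i => ξ (Sum.inr i)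

/-- For `ξ = (a, b)`, the function `x ↦ exp (i (a·x + a·b/2)) ψ(x + b)`. -/
def weylFun (ξ : Phase ι) (ψ : (ι → ℝ) → ℂ) (x : ι → ℝ) : ℂ :=
  Complex.exp (Complex.I *
      ((posPart ξ ⬝ᵥ x + (posPart ξ ⬝ᵥ momPart ξ) / 2 : ℝ) : ℂ)) * ψ (x + momPart ξ)

theorem memLp_weylFun (ξ : Phase ι) (ψ : Hilb ι) : MemLp (weylFun ξ ψ) 2 volume := by
  have h1 : MemLp (fun x => ψ (x + momPart ξ)) 2 (volume : Measure (ι → ℝ)) :=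
    (Lp.memLp ψ).comp_measurePreserving (measurePreserving_add_right volume (momPart ξ))
  have hc : Continuous fun x : ι → ℝ => Complex.exp (Complex.I *
      ((posPart ξ ⬝ᵥ x + (posPart ξ ⬝ᵥ momPart ξ) / 2 : ℝ) : ℂ)) := by
    have : Continuous fun x : ι → ℝ => posPart ξ ⬝ᵥ x :=
      continuous_const.dotProduct continuous_id
    fun_prop
  refine h1.of_le (hc.aestronglyMeasurable.mul h1.1) (Filter.Eventually.of_forall fun x => ?_)
  have : ‖Complex.exp (Complex.I *
      ((posPart ξ ⬝ᵥ x + (posPart ξ ⬝ᵥ momPart ξ) / 2 : ℝ) : ℂ))‖ = 1 := by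
    rw [mul_comm]; exact Complex.norm_exp_ofReal_mul_I _
  rw [weylFun, norm_mul, this, one_mul]

/-- The Weyl operator `W(ξ) = exp (i ξ·R)`, where `R` is the vector of the quadratures
`q_j` (multiplication by `x_j`) and `p_j = -i ∂/∂x_j`, so that `[q_j, p_k] = i δ_{jk}`. By
`exp (i (a·q + b·p)) = exp (i a·b/2) exp (i a·q) exp (i b·p)` it acts on wave functions as in
`weylFun`. -/
def weyl (ξ : Phase ι) (ψ : Hilb ι) : Hilb ι := (memLp_weylFun ξ ψ).toLp (weylFun ξ ψ)

variable [DecidableEq ι]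

/-- The coordinate vector of phase space with label `k`, so that `weyl (t • basisVec k)` is
`exp (i t R_k)`. -/
def basisVec (k : ι ⊕ ι) : Phase ι := Pi.single k 1

/-- `ψ` lies in the domain of the self-adjoint operator `R_k`, the generator of the unitary group
`t ↦ exp (i t R_k)` in the sense of Stone: this orbit of `ψ` is differentiable in norm. -/
def InDomain (k : ι ⊕ ι) (ψ : Hilb ι) : Prop :=
  DifferentiableAt ℝ (fun t : ℝ => weyl (t • basisVec k) ψ) 0

/-- The vector `R_k ψ` for `ψ` in the domain of the quadrature `R_k`. -/
def quad (k : ι ⊕ ι) (ψ : Hilb ι) : Hilb ι :=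
  (-Complex.I) • deriv (fun t : ℝ => weyl (t • basisVec k) ψ) 0

open Classical in
/-- The mean energy `⟨ψ, H ψ⟩` for `H = (1/2) ∑_j (q_j² + p_j²)`, as the value of the closed
quadratic form of `H`; it is infinite outside the form domain. -/
def energy (ψ : Hilb ι) : ℝ≥0∞ :=
  if ∀ k, InDomain k ψ then ENNReal.ofReal ((1 / 2) * ∑ k : ι ⊕ ι, ‖quad k ψ‖ ^ 2) else ⊤

/-- The first moments `⟨R_k⟩` in the state `|ψ⟩⟨ψ|`. -/
def firstMoment (ψ : Hilb ι) (k : ι ⊕ ι) : ℝ := (inner ℂ ψ (quad k ψ)).re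

/-- The covariance matrix `⟨R_k R_l + R_l R_k⟩ - 2 ⟨R_k⟩ ⟨R_l⟩` of the state `|ψ⟩⟨ψ|`. -/
def covMatrix (ψ : Hilb ι) : Matrix (ι ⊕ ι) (ι ⊕ ι) ℝ :=
  Matrix.of fun k l =>
    (inner ℂ (quad k ψ) (quad l ψ) + inner ℂ (quad l ψ) (quad k ψ)).re
      - 2 * firstMoment ψ k * firstMoment ψ l

/-- `|ψ⟩⟨ψ|` is a (pure) Gaussian state: `ψ` is a unit vector and the characteristic function
`ξ ↦ Tr (|ψ⟩⟨ψ| W(ξ))` is Gaussian. -/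
def IsPureGaussian (ψ : Hilb ι) : Prop :=
  ‖ψ‖ = 1 ∧ ∃ (d : Phase ι) (C : Matrix (ι ⊕ ι) (ι ⊕ ι) ℝ), ∀ ξ : Phase ι,
    inner ℂ ψ (weyl ξ ψ) =
      Complex.exp (Complex.I * ((ξ ⬝ᵥ d : ℝ) : ℂ) - ((ξ ⬝ᵥ (C *ᵥ ξ) : ℝ) : ℂ) / 4)

/-- Gaussian unitaries: in the Heisenberg picture they act on the quadratures by an affine
symplectic map, `U† R U = S R + s`; in exponentiated form,
`U† exp (i ξ·R) U = exp (i ξ·(S R + s))`. -/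
def IsGaussianUnitary (U : Hilb ι ≃ₗᵢ[ℂ] Hilb ι) : Prop :=
  ∃ S ∈ symplecticGroup ι ℝ, ∃ s : Phase ι, ∀ (ξ : Phase ι) (ψ : Hilb ι),
    U.symm (weyl ξ (U ψ)) =
      Complex.exp (Complex.I * ((ξ ⬝ᵥ s : ℝ) : ℂ)) • weyl (Sᵀ *ᵥ ξ) ψ

/-- `ν` lists the symplectic eigenvalues (with multiplicity) of `C`: `C` has the Williamson
normal form `diag (ν, ν)` under symplectic congruence. -/
def IsSymplecticSpectrum (C : Matrix (ι ⊕ ι) (ι ⊕ ι) ℝ) (ν : ι → ℝ) : Prop :=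
  (∀ i, 0 < ν i) ∧
    ∃ S ∈ symplecticGroup ι ℝ, S * C * Sᵀ = Matrix.diagonal (Sum.elim ν ν)

/-- The global Gaussian ergotropy `Tr (ρ H) - min_U Tr (U ρ U† H)` of `ρ = |ψ⟩⟨ψ|`. -/
def globalErgotropy (ψ : Hilb ι) : ℝ :=
  (energy ψ).toReal -
    (⨅ (U : Hilb ι ≃ₗᵢ[ℂ] Hilb ι) (_ : IsGaussianUnitary U), energy (U ψ)).toReal

end OneSystem

section TwoSystems

variable {ι κ : Type*} [Fintype ι] [Fintype κ]

/-- The product wave function `(x, y) ↦ f(x) g(y)`. -/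
def tensorFun (f : (ι → ℝ) → ℂ) (g : (κ → ℝ) → ℂ) (x : ι ⊕ κ → ℝ) : ℂ :=
  f (fun i => x (Sum.inl i)) * g (fun j => x (Sum.inr j))

theorem memLp_tensorFun (f : Hilb ι) (g : Hilb κ) : MemLp (tensorFun f g) 2 volume := by
  have hmp := volume_measurePreserving_sumPiEquivProdPi (fun _ : ι ⊕ κ => ℝ)
  have hf := Lp.memLp f
  have hg := Lp.memLp g
  have h : MemLp (fun z : (ι → ℝ) × (κ → ℝ) => f z.1 * g z.2) 2
      ((volume : Measure (ι → ℝ)).prod (volume : Measure (κ → ℝ))) := by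
    have hm : AEStronglyMeasurable (fun z : (ι → ℝ) × (κ → ℝ) => f z.1 * g z.2)
        ((volume : Measure (ι → ℝ)).prod (volume : Measure (κ → ℝ))) :=
      (hf.1.comp_fst).mul (hg.1.comp_snd)
    rw [memLp_two_iff_integrable_sq_norm hm]
    have := ((memLp_two_iff_integrable_sq_norm hf.1).1 hf).mul_prod
      ((memLp_two_iff_integrable_sq_norm hg.1).1 hg)
    refine this.congr (Filter.Eventually.of_forall fun z => ?_)
    simp only [norm_mul, mul_pow]
  exact h.comp_measurePreserving hmp

/-- The product vector `f ⊗ g` in `L²(ℝ^ι × ℝ^κ) = L²(ℝ^ι) ⊗ L²(ℝ^κ)`. -/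
def tensor (f : Hilb ι) (g : Hilb κ) : Hilb (ι ⊕ κ) :=
  (memLp_tensorFun f g).toLp (tensorFun f g)

variable [DecidableEq ι] [DecidableEq κ]

/-- Local Gaussian unitaries `U = U₁ ⊗ U₂` for the bipartition of the modes into `ι` and `κ`. -/
def IsLocalGaussianUnitary (U : Hilb (ι ⊕ κ) ≃ₗᵢ[ℂ] Hilb (ι ⊕ κ)) : Prop :=
  ∃ (U₁ : Hilb ι ≃ₗᵢ[ℂ] Hilb ι) (U₂ : Hilb κ ≃ₗᵢ[ℂ] Hilb κ),
    IsGaussianUnitary U₁ ∧ IsGaussianUnitary U₂ ∧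
      ∀ (f : Hilb ι) (g : Hilb κ), U (tensor f g) = tensor (U₁ f) (U₂ g)

/-- The 2-local Gaussian ergotropy `Tr (ρ H) - min_{U₁ ⊗ U₂} Tr (U ρ U† H)` of `ρ = |ψ⟩⟨ψ|`. -/
def localErgotropy (ψ : Hilb (ι ⊕ κ)) : ℝ :=
  (energy ψ).toReal -
    (⨅ (U : Hilb (ι ⊕ κ) ≃ₗᵢ[ℂ] Hilb (ι ⊕ κ)) (_ : IsLocalGaussianUnitary U),
      energy (U ψ)).toReal

/-- The 2-local ergotropic gap. -/
def ergotropicGap (ψ : Hilb (ι ⊕ κ)) : ℝ := globalErgotropy ψ - localErgotropy ψ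

/-- The reduced covariance matrix of the first subsystem: the block of the entries that belong to
the quadratures of the modes in `ι`. -/
def reducedCov (C : Matrix ((ι ⊕ κ) ⊕ (ι ⊕ κ)) ((ι ⊕ κ) ⊕ (ι ⊕ κ)) ℝ) :
    Matrix (ι ⊕ ι) (ι ⊕ ι) ℝ :=
  C.submatrix (Sum.map Sum.inl Sum.inl) (Sum.map Sum.inl Sum.inl)

end TwoSystems

end CV

end

/-! A Gaussian unitary acts on a Gaussian state only through its moments, `d ↦ S d + s` and `C ↦ S C
Sᵀ` (`GaussianWith.map`), and the energy is `tr C / 4 + |d|² / 2` (`GaussianWith.energy_eq`). A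
displacement removes the second term, so both minimizations become minimizations of a trace under
symplectic congruence: by all symplectic matrices globally, by block diagonal ones locally. Twice
the sum of the symplectic eigenvalues is a lower bound (`two_mul_sum_le_trace`), attained at the
Williamson normal form (`exists_isSymplecticSpectrum`). Hence the minimal energies are half the sum
of the symplectic eigenvalues of `C`, respectively of its two diagonal blocks.

Purity enters twice. It forces all symplectic eigenvalues of `C` to be 1: in normal form `conj ψ(x)
ψ(x + b)` is an explicit Gaussian, and its factorized shape is compatible only with `ν = 1/ν`
(`GaussianWith.eq_one_of_diagonal`). So `C` is itself symplectic, and the blocks of `C J C = J`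
express the squares of the two reduced matrices `J A`, `J B` through products of the same two
off-diagonal factors in opposite order. These products have the same nonzero spectrum, so both
blocks have the same total excess `∑ (ν - 1)` (`sum_sub_one_eq_of_mem_symplecticGroup`). The gap is
half the sum of the two excesses.

Attainment needs actual unitaries. The Weyl orbit of a Gaussian vector with covariance `S Sᵀ` has
the same Gram matrix as the `Sᵀ`-relabelled Weyl orbit of the vector with covariance 1; both orbits
are total, so a unitary carries one to the other (`exists_implements_linear`). The same Gram matrix
argument yields `U₁ ⊗ U₂` (`exists_tensor_unitary`). -/

noncomputable section

namespace CV

/-! ### Complex matrices as real matrices commuting with `J` -/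

section Realify

/-- The real form of a complex matrix. -/
def realify {ι : Type*} (Z : Matrix ι ι ℂ) : Matrix (ι ⊕ ι) (ι ⊕ ι) ℝ :=
  fromBlocks (Z.map Complex.re) (-Z.map Complex.im) (Z.map Complex.im) (Z.map Complex.re)

theorem realify_conjTranspose {ι : Type*} (Z : Matrix ι ι ℂ) : realify Zᴴ = (realify Z)ᵀ := by
  simp only [realify, fromBlocks_transpose]
  congr 1
  ext i j
  simp

theorem realify_mul {ι : Type*} [Fintype ι] (Z W : Matrix ι ι ℂ) : realify (Z * W) = realify Z * realify W := by
  simp only [realify, fromBlocks_multiply]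
  congr 1 <;> ext i j <;>
    simp [Matrix.mul_apply, Finset.sum_add_distrib, sub_eq_add_neg] <;> ring

theorem realify_I {ι : Type*} [DecidableEq ι] : realify (Complex.I • (1 : Matrix ι ι ℂ)) = J ι ℝ := by
  simp only [realify, J]
  congr 1 <;> ext i j <;> by_cases h : i = j <;> simp [Matrix.one_apply, h]

theorem realify_diagonal {ι : Type*} [DecidableEq ι] (d : ι → ℝ) :
    realify (diagonal fun i => (d i : ℂ)) = diagonal (Sum.elim d d) := by
  rw [← fromBlocks_diagonal]
  simp only [realify]
  congr 1 <;> ext i j <;> by_cases h : i = j <;> simp [h]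

/-- Multiplication by `i` becomes `J`, so `V (i 1) Vᴴ = i 1` is the symplectic condition. -/
theorem realify_mem_symplecticGroup {ι : Type*} [Fintype ι] [DecidableEq ι] {V : Matrix ι ι ℂ} (hV : V * Vᴴ = 1) :
    realify V ∈ symplecticGroup ι ℝ := by
  rw [SymplecticGroup.mem_iff, ← realify_conjTranspose, ← realify_I, ← realify_mul, ← realify_mul]
  simp [hV]

end Realify

/-! ### Williamson's theorem by minimizing the trace -/

section Williamson

variable {ι : Type*} [Fintype ι] [DecidableEq ι]

/-- A positive definite real matrix is a Gram matrix `B * Bᵀ` with `B` invertible. -/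
theorem exists_eq_mul_transpose_of_posDef {n : Type*} [Fintype n] [DecidableEq n]
    {C : Matrix n n ℝ} (hC : C.PosDef) : ∃ B : Matrix n n ℝ, IsUnit B ∧ C = B * Bᵀ := by
  open scoped MatrixOrder in
  obtain ⟨B, hB, h⟩ := (CStarAlgebra.isStrictlyPositive_iff_eq_star_mul_self).1
    hC.isStrictlyPositive
  refine ⟨Bᵀ, by simpa using hB, ?_⟩
  rw [h]
  simp [Matrix.star_eq_conjTranspose]

theorem J_mulVec_dotProduct_self (v : ι ⊕ ι → ℝ) : v ⬝ᵥ (J ι ℝ *ᵥ v) = 0 := by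
  have h : v ⬝ᵥ (J ι ℝ *ᵥ v) = -(v ⬝ᵥ (J ι ℝ *ᵥ v)) := by
    conv_lhs => rw [dotProduct_mulVec, ← mulVec_transpose, J_transpose, neg_mulVec,
      neg_dotProduct, dotProduct_comm]
  linarith

/-- Symplectic transvections. -/
theorem transvection_mem_symplecticGroup (v : ι ⊕ ι → ℝ) (t : ℝ) :
    1 + t • (vecMulVec v v * J ι ℝ) ∈ symplecticGroup ι ℝ := by
  rw [SymplecticGroup.mem_iff]
  have h1 : vecMulVec v v * J ι ℝ * vecMulVec v v = 0 := by
    rw [Matrix.mul_assoc, Matrix.mul_vecMulVec, vecMulVec_mul_vecMulVec,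
      J_mulVec_dotProduct_self]
    simp
  have h2 : (vecMulVec v v : Matrix (ι ⊕ ι) (ι ⊕ ι) ℝ)ᵀ = vecMulVec v v := transpose_vecMulVec v v
  have hJ := J_squared ι ℝ
  simp only [transpose_add, transpose_one, transpose_smul, transpose_mul, J_transpose, h2,
    Matrix.add_mul, Matrix.mul_add, Matrix.one_mul, Matrix.mul_one, Matrix.smul_mul,
    Matrix.mul_smul, Matrix.neg_mul, Matrix.mul_neg, Matrix.mul_assoc, hJ]
  rw [← Matrix.mul_assoc (J ι ℝ) (J ι ℝ), hJ]
  simp only [Matrix.mul_assoc] at h1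
  simp [h1]

theorem isClosed_symplecticGroup :
    IsClosed (symplecticGroup ι ℝ : Set (Matrix (ι ⊕ ι) (ι ⊕ ι) ℝ)) := by
  have : (symplecticGroup ι ℝ : Set (Matrix (ι ⊕ ι) (ι ⊕ ι) ℝ)) = {A | A * J ι ℝ * Aᵀ = J ι ℝ} := by
    ext A; exact SymplecticGroup.mem_iff
  rw [this]
  exact isClosed_eq (by fun_prop) continuous_const

theorem trace_mul_transpose_self {n : Type*} [Fintype n] (T : Matrix n n ℝ) :
    (T * Tᵀ).trace = ∑ i, ∑ j, T i j ^ 2 := by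
  simp [Matrix.trace, Matrix.mul_apply, sq]

/-- `S ↦ tr (S C Sᵀ)` attains its minimum over the symplectic group. -/
theorem exists_trace_minimizer {C : Matrix (ι ⊕ ι) (ι ⊕ ι) ℝ} (hC : C.PosDef) :
    ∃ S ∈ symplecticGroup ι ℝ, ∀ T ∈ symplecticGroup ι ℝ,
      (S * C * Sᵀ).trace ≤ (T * C * Tᵀ).trace := by
  obtain ⟨B, hB, rfl⟩ := exists_eq_mul_transpose_of_posDef hC
  have hdet : IsUnit B.det := (Matrix.isUnit_iff_isUnit_det B).1 hB
  set c := (B * Bᵀ).trace with hc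
  have hcomm : ∀ S : Matrix (ι ⊕ ι) (ι ⊕ ι) ℝ,
      (S * (B * Bᵀ) * Sᵀ).trace = ∑ i, ∑ j, (S * B) i j ^ 2 := fun S => by
    rw [← trace_mul_transpose_self, transpose_mul]; simp only [Matrix.mul_assoc]
  -- In the variable `T = S B` the objective is the squared Frobenius norm. Only the sublevel set at
  -- `c`, the value at `S = 1`, matters; its entries satisfy `|T i j| ≤ √c ≤ c + 1`.
  let K : Set (Matrix (ι ⊕ ι) (ι ⊕ ι) ℝ) :=
    {T | (∀ i j, T i j ∈ Set.Icc (-(c + 1)) (c + 1)) ∧ T * B⁻¹ ∈ symplecticGroup ι ℝ}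
  have hc0 : 0 ≤ c := by rw [hc, trace_mul_transpose_self]; positivity
  have hmem : ∀ T : Matrix (ι ⊕ ι) (ι ⊕ ι) ℝ, ∑ i, ∑ j, T i j ^ 2 ≤ c →
      ∀ i j, T i j ∈ Set.Icc (-(c + 1)) (c + 1) := fun T hT i j => by
    have h1 : T i j ^ 2 ≤ c := by
      refine le_trans ?_ hT
      refine le_trans ?_ (Finset.single_le_sum (f := fun i => ∑ j, T i j ^ 2)
        (fun i _ => Finset.sum_nonneg fun j _ => sq_nonneg _) (Finset.mem_univ i))
      exact Finset.single_le_sum (f := fun j => T i j ^ 2) (fun j _ => sq_nonneg _)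
        (Finset.mem_univ j)
    exact abs_le.1 (abs_le_of_sq_le_sq (by nlinarith) (by linarith))
  have hK : IsCompact K := by
    have hbox : IsCompact {T : Matrix (ι ⊕ ι) (ι ⊕ ι) ℝ |
        ∀ i j, T i j ∈ Set.Icc (-(c + 1)) (c + 1)} := by
      have := isCompact_univ_pi (X := fun _ : ι ⊕ ι => ι ⊕ ι → ℝ) fun _ =>
        isCompact_univ_pi (X := fun _ : ι ⊕ ι => ℝ) fun _ =>
          (isCompact_Icc : IsCompact (Set.Icc (-(c + 1)) (c + 1)))
      have e : {T : Matrix (ι ⊕ ι) (ι ⊕ ι) ℝ | ∀ i j, T i j ∈ Set.Icc (-(c + 1)) (c + 1)} =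
          Set.pi Set.univ fun _ => Set.pi Set.univ fun _ => Set.Icc (-(c + 1)) (c + 1) := by
        exact Set.ext fun T => ⟨fun h i _ j _ => h i j, fun h i j => h i trivial j trivial⟩
      rw [e]
      exact this
    refine hbox.inter_right (t := {T | T * B⁻¹ ∈ symplecticGroup ι ℝ}) ?_
    exact isClosed_symplecticGroup.preimage (f := fun T : Matrix (ι ⊕ ι) (ι ⊕ ι) ℝ => T * B⁻¹)
      (by fun_prop)
  have hBK : B ∈ K := by
    refine ⟨hmem B ?_, ?_⟩
    · rw [← trace_mul_transpose_self]
    · rw [Matrix.mul_nonsing_inv _ hdet]; exact one_mem _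
  obtain ⟨T, hTK, hT⟩ := hK.exists_isMinOn ⟨B, hBK⟩
    (f := fun T : Matrix (ι ⊕ ι) (ι ⊕ ι) ℝ => ∑ i, ∑ j, T i j ^ 2)
    (Continuous.continuousOn (by
      refine continuous_finsetSum _ fun i _ => continuous_finsetSum _ fun j _ => ?_
      exact (continuous_id.matrix_elem i j).pow 2))
  refine ⟨T * B⁻¹, hTK.2, fun S hS => ?_⟩
  rw [hcomm, hcomm, Matrix.nonsing_inv_mul_cancel_right _ _ hdet]
  by_cases h : ∑ i, ∑ j, (S * B) i j ^ 2 ≤ c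
  · exact hT (show S * B ∈ K from
      ⟨hmem _ h, by rwa [Matrix.mul_nonsing_inv_cancel_right _ _ hdet]⟩)
  · refine le_trans (hT hBK) ?_
    simp only
    rw [← trace_mul_transpose_self]
    exact (not_le.1 h).le

/-- If the trace of `C` cannot be lowered by symplectic congruence, `C` commutes with `J`. -/
theorem commute_J_of_trace_le {C : Matrix (ι ⊕ ι) (ι ⊕ ι) ℝ} (hC : C.IsSymm)
    (h : ∀ T ∈ symplecticGroup ι ℝ, C.trace ≤ (T * C * Tᵀ).trace) : J ι ℝ * C = C * J ι ℝ := by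
  have key : ∀ v : ι ⊕ ι → ℝ, v ⬝ᵥ ((J ι ℝ * C) *ᵥ v) = 0 := by
    intro v
    set X := vecMulVec v v * J ι ℝ with hX
    have hXC : (X * C).trace = v ⬝ᵥ ((J ι ℝ * C) *ᵥ v) := by
      rw [hX, Matrix.mul_assoc, Matrix.trace_mul_comm, Matrix.mul_vecMulVec, trace_vecMulVec,
        dotProduct_comm]
    rw [← hXC]
    set a := (X * C).trace
    set b := (X * C * Xᵀ).trace
    -- The transvections `1 + t X` form a curve through 1 along which the trace is quadratic in `t`;
    -- minimality at `t = 0` makes its linear coefficient `2 a` vanish.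
    have hexp : ∀ t : ℝ, 0 ≤ 2 * t * a + t ^ 2 * b := by
      intro t
      have h1 := h _ (transvection_mem_symplecticGroup v t)
      have h2 : ((1 + t • X) * C * (1 + t • X)ᵀ).trace = C.trace + 2 * t * a + t ^ 2 * b := by
        have h3 : (C * Xᵀ).trace = a := by
          rw [← Matrix.trace_transpose, transpose_mul, transpose_transpose, hC.eq]
        simp only [transpose_add, transpose_one, transpose_smul, Matrix.add_mul, Matrix.mul_add,
          Matrix.one_mul, Matrix.mul_one, Matrix.smul_mul, Matrix.mul_smul, trace_add, trace_smul,
          h3, smul_eq_mul]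
        ring
      rw [← hX, h2] at h1
      linarith
    by_contra ha
    -- This `t` is small enough for the linear term to dominate: the expression equals `a² / (|b| +
    -- 1)²` times `b - 2 (|b| + 1) < 0`.
    have hb := hexp (-a / (|b| + 1))
    have hb1 : 0 < |b| + 1 := by positivity
    have : 2 * (-a / (|b| + 1)) * a + (-a / (|b| + 1)) ^ 2 * b
        = a ^ 2 / (|b| + 1) ^ 2 * (b - 2 * (|b| + 1)) := by field_simp; ring
    rw [this] at hb
    have h5 : 0 < a ^ 2 / (|b| + 1) ^ 2 := by positivity
    nlinarith [le_abs_self b, abs_nonneg b]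
  -- A vanishing quadratic form has zero symmetric part; for symmetric `C` this is commutation with
  -- `J`.
  have hpol : J ι ℝ * C + (J ι ℝ * C)ᵀ = 0 := by
    ext i j
    have h1 := key (Pi.single i 1 + Pi.single j 1)
    have h2 := key (Pi.single i 1)
    have h3 := key (Pi.single j 1)
    simp only [mulVec_add, dotProduct_add, add_dotProduct, h2, h3] at h1
    simp at h1
    rw [Matrix.add_apply, transpose_apply, Matrix.zero_apply]
    linarith
  rw [transpose_mul, J_transpose, hC.eq, Matrix.mul_neg, ← sub_eq_add_neg, sub_eq_zero] at hpol
  exact hpol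

/-- **Williamson's theorem.** -/
theorem exists_isSymplecticSpectrum {C : Matrix (ι ⊕ ι) (ι ⊕ ι) ℝ} (hC : C.PosDef) :
    ∃ ν : ι → ℝ, IsSymplecticSpectrum C ν := by
  obtain ⟨S, hS, hmin⟩ := exists_trace_minimizer hC
  set D := S * C * Sᵀ with hD
  have hsymm : C.IsSymm := by simpa using hC.isHermitian
  have hDsymm : D.IsSymm := by
    rw [IsSymm, hD]; simp [Matrix.mul_assoc, hsymm.eq]
  have hcomm : J ι ℝ * D = D * J ι ℝ := by
    refine commute_J_of_trace_le hDsymm fun T hT => ?_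
    have := hmin (T * S) (mul_mem hT hS)
    simpa [hD, Matrix.mul_assoc, transpose_mul] using this
  have hpos : ∀ T ∈ symplecticGroup ι ℝ, ∀ k, 0 < (T * C * Tᵀ) k k := by
    intro T hT k
    have hT' : IsUnit T := (Matrix.isUnit_iff_isUnit_det T).2 (SymplecticGroup.symplectic_det hT)
    have h1 : (T * C * Tᵀ).PosDef := by
      have := hC.mul_mul_conjTranspose_same (B := T)
        (Matrix.vecMul_injective_iff_isUnit.2 hT')
      simpa using this
    exact h1.diag_pos
  -- Commuting with `J` means being complex linear, so the minimizer `D` is the real form of a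
  -- complex matrix `Z`, Hermitian because `D` is symmetric. A unitary diagonalization of `Z` is a
  -- symplectic one of `D`, with every eigenvalue doubled.
  let Z : Matrix ι ι ℂ := Matrix.of fun i j => ⟨D (Sum.inl i) (Sum.inl j), D (Sum.inr i) (Sum.inl j)⟩
  have hblocks : ∃ P Q R T, D = fromBlocks P Q R T := ⟨_, _, _, _, (fromBlocks_toBlocks D).symm⟩
  have hZ : realify Z = D := by
    obtain ⟨P, Q, R, T, hDb⟩ := hblocks
    rw [hDb, J, fromBlocks_multiply, fromBlocks_multiply] at hcomm
    simp only [Matrix.zero_mul, Matrix.mul_zero, Matrix.neg_mul, Matrix.mul_neg, Matrix.one_mul,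
      Matrix.mul_one, zero_add, add_zero, fromBlocks_inj] at hcomm
    obtain ⟨h1, -, h3, -⟩ := hcomm
    have hT : T = P := h3.symm
    rw [hDb, realify]
    congr 1
    · ext i j; simp [Z, hDb]
    · rw [← h1]; ext i j; simp [Z, hDb]
    · ext i j; simp [Z, hDb]
    · rw [hT]; ext i j; simp [Z, hDb]
  have hinj : Z.IsHermitian := by
    have h1 : realify Zᴴ = realify Z := by rw [realify_conjTranspose, hZ, hDsymm.eq]
    simp only [realify, fromBlocks_inj] at h1
    ext i j
    apply Complex.ext
    · exact congrFun (congrFun h1.1 i) j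
    · exact congrFun (congrFun h1.2.2.1 i) j
  set V : Matrix ι ι ℂ := (hinj.eigenvectorUnitary : Matrix ι ι ℂ) with hVdef
  have hV1 : Vᴴ * V = 1 := Unitary.coe_star_mul_self hinj.eigenvectorUnitary
  have hV2 : Vᴴ * Z * V = diagonal fun i => (hinj.eigenvalues i : ℂ) := by
    have := hinj.spectral_theorem
    rw [Unitary.conjStarAlgAut_apply] at this
    conv_lhs => rw [this]
    have e : (star (hinj.eigenvectorUnitary) : Matrix ι ι ℂ) = Vᴴ := rfl
    rw [e, ← hVdef]
    simp only [Matrix.mul_assoc, hV1, Matrix.mul_one]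
    rw [← Matrix.mul_assoc, hV1, Matrix.one_mul]
    rfl
  have hO : realify Vᴴ ∈ symplecticGroup ι ℝ := realify_mem_symplecticGroup (by simpa using hV1)
  have hfin : (realify Vᴴ * S) * C * (realify Vᴴ * S)ᵀ
      = diagonal (Sum.elim hinj.eigenvalues hinj.eigenvalues) := by
    rw [← realify_diagonal, ← hV2, realify_mul, realify_mul, hZ, hD, transpose_mul,
      ← realify_conjTranspose, conjTranspose_conjTranspose]
    simp only [Matrix.mul_assoc]
  refine ⟨hinj.eigenvalues, fun i => ?_, realify Vᴴ * S, mul_mem hO hS, hfin⟩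
  have := hpos _ (mul_mem hO hS) (Sum.inl i)
  rw [hfin] at this
  simpa using this

end Williamson

/-! ### Lower bound for the trace under symplectic congruence -/

section TraceBound
variable {ι : Type*} [Fintype ι] [DecidableEq ι]

/-- The two columns of a conjugate pair have symplectic product of modulus 1. After rotating one of
them by `J` this is an ordinary inner product `-1`, and `|u + v|² ≥ 0` gives the bound. -/
theorem two_le_norm_sq_columns {S : Matrix (ι ⊕ ι) (ι ⊕ ι) ℝ} (hS : S ∈ symplecticGroup ι ℝ)
    (i : ι) : 2 ≤ (Sᵀ * S) (Sum.inl i) (Sum.inl i) + (Sᵀ * S) (Sum.inr i) (Sum.inr i) := by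
  set u := S.col (Sum.inl i)
  set v := J ι ℝ *ᵥ S.col (Sum.inr i)
  have h1 : (Sᵀ * S) (Sum.inl i) (Sum.inl i) = u ⬝ᵥ u := rfl
  have h2 : (Sᵀ * S) (Sum.inr i) (Sum.inr i) = v ⬝ᵥ v := by
    have : v ⬝ᵥ v = S.col (Sum.inr i) ⬝ᵥ S.col (Sum.inr i) := by
      simp only [v]
      rw [dotProduct_mulVec, ← mulVec_transpose, J_transpose, mulVec_mulVec, Matrix.neg_mul,
        J_squared]
      simp
    rw [this]; rfl
  have h3 : u ⬝ᵥ v = -1 := by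
    have h := congrFun (congrFun (SymplecticGroup.mem_iff'.1 hS) (Sum.inl i)) (Sum.inr i)
    have e : (Sᵀ * J ι ℝ * S) (Sum.inl i) (Sum.inr i) = u ⬝ᵥ v := by
      rw [Matrix.mul_assoc]
      simp only [Matrix.mul_apply, transpose_apply, dotProduct, u, v, mulVec, Matrix.col_apply]
    rw [e] at h
    simpa [J] using h
  have h4 : 0 ≤ (u + v) ⬝ᵥ (u + v) := Finset.sum_nonneg fun _ _ => mul_self_nonneg _
  rw [h1, h2]
  simp only [add_dotProduct, dotProduct_add, dotProduct_comm v u, h3] at h4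
  linarith

/-- Symplectic congruence cannot lower the trace of a Williamson normal form. -/
theorem two_mul_sum_le_trace {C : Matrix (ι ⊕ ι) (ι ⊕ ι) ℝ} {ν : ι → ℝ}
    (h : IsSymplecticSpectrum C ν) {T : Matrix (ι ⊕ ι) (ι ⊕ ι) ℝ} (hT : T ∈ symplecticGroup ι ℝ) :
    2 * ∑ i, ν i ≤ (T * C * Tᵀ).trace := by
  obtain ⟨hν, S, hS, hSC⟩ := h
  have hdet := SymplecticGroup.symplectic_det hS
  have hSi : S⁻¹ ∈ symplecticGroup ι ℝ := by
    have := (⟨S, hS⟩⁻¹ : symplecticGroup ι ℝ).2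
    rwa [SymplecticGroup.coe_inv'] at this
  set R := T * S⁻¹
  have hR : R ∈ symplecticGroup ι ℝ := mul_mem hT hSi
  have hTR : T = R * S := by simp [R, Matrix.nonsing_inv_mul_cancel_right _ _ hdet]
  have h1 : (T * C * Tᵀ).trace = ((Rᵀ * R) * diagonal (Sum.elim ν ν)).trace := by
    have h2 : T * C * Tᵀ = R * (diagonal (Sum.elim ν ν) * Rᵀ) := by
      rw [← hSC, hTR]
      simp only [transpose_mul, Matrix.mul_assoc]
    rw [h2, Matrix.trace_mul_comm, Matrix.mul_assoc, Matrix.trace_mul_comm]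
  rw [h1, Matrix.trace]
  simp only [diag_apply, mul_diagonal, Fintype.sum_sum_type, Sum.elim_inl, Sum.elim_inr]
  rw [← Finset.sum_add_distrib, Finset.mul_sum]
  refine Finset.sum_le_sum fun i _ => ?_
  nlinarith [two_le_norm_sq_columns hR i, hν i]

end TraceBound

/-! ### Equal excess of the two reduced covariance matrices -/

section ReducedSpectra

open Polynomial

variable {ι κ : Type*} [Fintype ι] [DecidableEq ι] [Fintype κ] [DecidableEq κ]

/-- Symplectic congruence of `A` is a similarity of `J A`, since `J S⁻¹ = Sᵀ J`. In normal form `(J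
D)² = -diag(ν², ν²)`, so each `ν i ^ 2 - 1` is a double root. -/
theorem charpoly_of_isSymplecticSpectrum {A : Matrix (ι ⊕ ι) (ι ⊕ ι) ℝ} {ν : ι → ℝ}
    (h : IsSymplecticSpectrum A ν) :
    (-1 - J ι ℝ * A * (J ι ℝ * A)).charpoly = (∏ i, (X - C (ν i ^ 2 - 1))) ^ 2 := by
  obtain ⟨-, S, hS, hSA⟩ := h
  have hdet := SymplecticGroup.symplectic_det hS
  have hdet' : IsUnit (Sᵀ).det := by rwa [det_transpose]
  set D := diagonal (Sum.elim ν ν) with hD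
  have hA : A = S⁻¹ * D * (Sᵀ)⁻¹ := by
    rw [← hSA, Matrix.mul_assoc, Matrix.mul_assoc, Matrix.mul_assoc,
      Matrix.mul_nonsing_inv _ hdet', Matrix.mul_one, Matrix.nonsing_inv_mul_cancel_left _ _ hdet]
  have hJS : J ι ℝ * S⁻¹ = Sᵀ * J ι ℝ := by
    rw [← SymplecticGroup.mem_iff'.1 hS, Matrix.mul_nonsing_inv_cancel_right _ _ hdet,
      SymplecticGroup.mem_iff'.1 hS]
  have hJA : J ι ℝ * A = Sᵀ * (J ι ℝ * D) * (Sᵀ)⁻¹ := by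
    rw [hA, ← Matrix.mul_assoc, ← Matrix.mul_assoc, hJS, ← Matrix.mul_assoc]
  have hJD : J ι ℝ * D * (J ι ℝ * D) = -diagonal (Sum.elim (fun i => ν i ^ 2) fun i => ν i ^ 2) := by
    rw [hD, ← fromBlocks_diagonal, ← fromBlocks_diagonal, J, fromBlocks_multiply,
      fromBlocks_multiply, fromBlocks_neg]
    congr 1 <;> simp [sq]
  have hconj : -1 - J ι ℝ * A * (J ι ℝ * A) =
      Sᵀ * diagonal (Sum.elim (fun i => ν i ^ 2 - 1) fun i => ν i ^ 2 - 1) * (Sᵀ)⁻¹ := by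
    have h1 : diagonal (Sum.elim (fun i => ν i ^ 2 - 1) fun i => ν i ^ 2 - 1)
        = -1 - J ι ℝ * D * (J ι ℝ * D) := by
      rw [hJD]
      ext i j
      by_cases hij : i = j
      · subst hij; rcases i with i | i <;> simp <;> ring
      · simp [hij]
    rw [h1, Matrix.mul_sub, Matrix.sub_mul, hJA]
    congr 1
    · rw [Matrix.mul_neg, Matrix.mul_one, Matrix.neg_mul, Matrix.mul_nonsing_inv _ hdet']
    · simp only [Matrix.mul_assoc]
      rw [Matrix.nonsing_inv_mul_cancel_left _ _ hdet']
  rw [hconj, Matrix.charpoly_mul_comm, ← Matrix.mul_assoc, Matrix.nonsing_inv_mul _ hdet',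
    Matrix.one_mul, Matrix.charpoly_diagonal, Fintype.prod_sum_type]
  simp [sq]

/-- The map `r ↦ √(r + 1) - 1` sends `ν² - 1` to `ν - 1` and kills the root 0. The sum is thus
insensitive to the power of `X` by which the characteristic polynomials of `M N` and `N M` differ.
-/
theorem sum_sqrt_roots {ι : Type*} [Fintype ι] (n : ℕ) (ν : ι → ℝ) (hν : ∀ i, 0 < ν i) :
    (((X ^ n * (∏ i, (X - C (ν i ^ 2 - 1))) ^ 2 : ℝ[X]).roots.map
      fun r => Real.sqrt (r + 1) - 1).sum) = 2 * ∑ i, (ν i - 1) := by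
  have hp : (∏ i, (X - C (ν i ^ 2 - 1)) : ℝ[X]) ≠ 0 :=
    Finset.prod_ne_zero_iff.2 fun i _ => X_sub_C_ne_zero _
  rw [roots_mul (mul_ne_zero (pow_ne_zero _ X_ne_zero) (pow_ne_zero _ hp)), roots_pow, roots_pow,
    roots_X, roots_prod _ _ hp]
  simp only [roots_X_sub_C, Multiset.bind_singleton, Multiset.map_add, Multiset.sum_add,
    Multiset.map_nsmul, Multiset.sum_nsmul, Multiset.map_singleton, Multiset.sum_singleton,
    Multiset.map_map, Function.comp_def, sub_add_cancel, zero_add, Real.sqrt_one, sub_self,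
    smul_zero, nsmul_eq_mul, Nat.cast_ofNat]
  simp [Real.sqrt_sq (hν _).le]

/-- The block of the entries that belong to the quadratures of the second subsystem. -/
def reducedCov' {ι κ : Type*} (C : Matrix ((ι ⊕ κ) ⊕ (ι ⊕ κ)) ((ι ⊕ κ) ⊕ (ι ⊕ κ)) ℝ) :
    Matrix (κ ⊕ κ) (κ ⊕ κ) ℝ :=
  C.submatrix (Sum.map Sum.inr Sum.inr) (Sum.map Sum.inr Sum.inr)

/-- Both blocks of a symmetric symplectic matrix have the same symplectic eigenvalues, up to
ones. -/
theorem sum_sub_one_eq_of_mem_symplecticGroup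
    {M : Matrix ((ι ⊕ κ) ⊕ (ι ⊕ κ)) ((ι ⊕ κ) ⊕ (ι ⊕ κ)) ℝ} (hsymm : M.IsSymm)
    (hM : M ∈ symplecticGroup (ι ⊕ κ) ℝ) {ν : ι → ℝ} {μ : κ → ℝ}
    (hν : IsSymplecticSpectrum (reducedCov M) ν) (hμ : IsSymplecticSpectrum (reducedCov' M) μ) :
    ∑ i, (ν i - 1) = ∑ j, (μ j - 1) := by
  set A := reducedCov M with hA
  set B := reducedCov' M with hB
  set Γ : Matrix (ι ⊕ ι) (κ ⊕ κ) ℝ :=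
    M.submatrix (Sum.map Sum.inl Sum.inl) (Sum.map Sum.inr Sum.inr) with hΓ
  -- Regrouping the coordinates from (positions, momenta) to (first system, second system) makes `J`
  -- block diagonal and exposes the correlation block `Γ`.
  let e := Equiv.sumSumSumComm ι ι κ κ
  have hMe : M.submatrix e e = fromBlocks A Γ Γᵀ B := by
    ext i j
    rcases i with (i | i) | (i | i) <;> rcases j with (j | j) | (j | j) <;>
      first | rfl | exact hsymm.apply _ _
  have hJe : (J (ι ⊕ κ) ℝ).submatrix e e = fromBlocks (J ι ℝ) 0 0 (J κ ℝ) := by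
    ext i j
    rcases i with (i | i) | (i | i) <;> rcases j with (j | j) | (j | j) <;>
      simp [e, J, Matrix.one_apply]
  have key : fromBlocks A Γ Γᵀ B * fromBlocks (J ι ℝ) 0 0 (J κ ℝ) * fromBlocks A Γ Γᵀ B
      = fromBlocks (J ι ℝ) 0 0 (J κ ℝ) := by
    rw [← hMe, ← hJe, submatrix_mul_equiv, submatrix_mul_equiv]
    have := SymplecticGroup.mem_iff.1 hM
    rw [hsymm.eq] at this
    rw [this]
  rw [fromBlocks_multiply, fromBlocks_multiply, fromBlocks_inj] at key
  simp only [Matrix.mul_zero, add_zero, zero_add] at key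
  obtain ⟨h1, -, -, h2⟩ := key
  have hG1 : J ι ℝ * Γ * (J κ ℝ * Γᵀ) = -1 - J ι ℝ * A * (J ι ℝ * A) := by
    rw [eq_sub_iff_add_eq', ← J_squared ι ℝ]
    have := congrArg (J ι ℝ * ·) h1
    simpa only [Matrix.mul_add, Matrix.mul_assoc] using this
  have hG2 : J κ ℝ * Γᵀ * (J ι ℝ * Γ) = -1 - J κ ℝ * B * (J κ ℝ * B) := by
    rw [eq_sub_iff_add_eq, ← J_squared κ ℝ]
    have := congrArg (J κ ℝ * ·) h2
    simpa only [Matrix.mul_add, Matrix.mul_assoc] using this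
  -- The two products of `J Γ` and `J Γᵀ` have different sizes when the systems do; their
  -- characteristic polynomials agree up to powers of `X`.
  have hchar := Matrix.charpoly_mul_comm' (J ι ℝ * Γ) (J κ ℝ * Γᵀ)
  rw [hG1, hG2, charpoly_of_isSymplecticSpectrum hν, charpoly_of_isSymplecticSpectrum hμ] at hchar
  have hroots := congrArg (fun p : ℝ[X] =>
    (p.roots.map fun r => Real.sqrt (r + 1) - 1).sum) hchar
  simp only [sum_sqrt_roots _ _ hν.1, sum_sqrt_roots _ _ hμ.1] at hroots
  linarith

end ReducedSpectra

/-! ### Unitaries from equal Gram matrices -/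

section Gram

theorem denseRange_linearCombination {G α : Type*} [NormedAddCommGroup G] [InnerProductSpace ℂ G]
    (u : α → G) (hu : (Submodule.span ℂ (Set.range u)).topologicalClosure = ⊤) :
    DenseRange (Finsupp.linearCombination ℂ u) := by
  have : Set.range (Finsupp.linearCombination ℂ u) = Submodule.span ℂ (Set.range u) := by
    rw [← Finsupp.range_linearCombination]; rfl
  rw [DenseRange, this]
  exact Submodule.dense_iff_topologicalClosure_eq_top.2 hu

/-- Two total families of vectors with the same Gram matrix are related by a unitary. -/
theorem exists_linearIsometryEquiv_of_inner_eq {E F α : Type*} [NormedAddCommGroup E]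
    [InnerProductSpace ℂ E] [CompleteSpace E] [NormedAddCommGroup F] [InnerProductSpace ℂ F]
    [CompleteSpace F] (v : α → E) (w : α → F)
    (hv : (Submodule.span ℂ (Set.range v)).topologicalClosure = ⊤)
    (hw : (Submodule.span ℂ (Set.range w)).topologicalClosure = ⊤)
    (h : ∀ i j, inner ℂ (v i) (v j) = inner ℂ (w i) (w j)) :
    ∃ U : E ≃ₗᵢ[ℂ] F, ∀ i, U (v i) = w i := by
  have hnorm : ∀ x : α →₀ ℂ, ‖Finsupp.linearCombination ℂ w x‖ =
      ‖Finsupp.linearCombination ℂ v x‖ := by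
    intro x
    have : inner ℂ (Finsupp.linearCombination ℂ w x) (Finsupp.linearCombination ℂ w x) =
        inner ℂ (Finsupp.linearCombination ℂ v x) (Finsupp.linearCombination ℂ v x) := by
      simp only [Finsupp.linearCombination_apply, Finsupp.sum, sum_inner, inner_sum,
        inner_smul_left, inner_smul_right, h]
    rw [inner_self_eq_norm_sq_to_K, inner_self_eq_norm_sq_to_K] at this
    have h2 : ‖Finsupp.linearCombination ℂ w x‖ ^ 2 = ‖Finsupp.linearCombination ℂ v x‖ ^ 2 := by
      exact_mod_cast this
    exact (pow_left_inj₀ (norm_nonneg _) (norm_nonneg _) two_ne_zero).1 h2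
  refine ⟨(LinearEquiv.refl ℂ (α →₀ ℂ)).extendOfIsometry (Finsupp.linearCombination ℂ v)
    (Finsupp.linearCombination ℂ w) (denseRange_linearCombination v hv) (denseRange_linearCombination w hw) hnorm, fun i => ?_⟩
  have := LinearEquiv.extendOfIsometry_eq (LinearEquiv.refl ℂ (α →₀ ℂ))
    (Finsupp.linearCombination ℂ v) (Finsupp.linearCombination ℂ w) (denseRange_linearCombination v hv) (denseRange_linearCombination w hw)
    hnorm (Finsupp.single i 1)
  simpa using this

end Gram

/-! ### Injectivity of the Fourier transform on integrable functions -/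

section Fourier

variable {ι : Type*} [Fintype ι]

theorem continuous_character (a : ι → ℝ) :
    Continuous fun x : ι → ℝ => Complex.exp (Complex.I * ((a ⬝ᵥ x : ℝ) : ℂ)) := by
  have : Continuous fun x : ι → ℝ => a ⬝ᵥ x := continuous_const.dotProduct continuous_id
  fun_prop

theorem norm_character (t : ℝ) : ‖Complex.exp (Complex.I * (t : ℂ))‖ = 1 := by
  rw [mul_comm]; exact Complex.norm_exp_ofReal_mul_I _

theorem integrable_character_mul (a : ι → ℝ) {f : (ι → ℝ) → ℂ} (hf : Integrable f) :
    Integrable fun x : ι → ℝ => Complex.exp (Complex.I * ((a ⬝ᵥ x : ℝ) : ℂ)) * f x :=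
  hf.bdd_mul (c := 1) (continuous_character a).aestronglyMeasurable
    (Filter.Eventually.of_forall fun _ => (norm_character _).le)

/-- The positive and negative parts of `u` are densities of finite measures with the same
characteristic function, hence of the same measure. Having disjoint supports, both parts vanish. -/
theorem ae_eq_zero_of_fourier_eq_zero_real {u : (ι → ℝ) → ℝ} (hu : Integrable u)
    (h : ∀ a : ι → ℝ, ∫ x, Complex.exp (Complex.I * ((a ⬝ᵥ x : ℝ) : ℂ)) * (u x : ℂ) = 0) :
    u =ᵐ[volume] 0 := by
  classical
  let μ := (volume : Measure (ι → ℝ)).withDensity fun x => ENNReal.ofReal (u x)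
  let ν := (volume : Measure (ι → ℝ)).withDensity fun x => ENNReal.ofReal (-u x)
  have hu' : Integrable fun x => -u x := hu.neg
  have : IsFiniteMeasure μ := isFiniteMeasure_withDensity_ofReal hu.2
  have : IsFiniteMeasure ν := isFiniteMeasure_withDensity_ofReal hu'.2
  have hμν : μ = ν := by
    apply Measure.ext_of_charFunDual
    funext L
    rw [charFunDual_apply, charFunDual_apply,
      integral_withDensity_eq_integral_toReal_smul₀ hu.aemeasurable.ennreal_ofReal (by simp),
      integral_withDensity_eq_integral_toReal_smul₀ hu'.aemeasurable.ennreal_ofReal (by simp),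
      ← sub_eq_zero]
    let a : ι → ℝ := fun i => L (Pi.single i 1)
    have hL : ∀ x, L x = a ⬝ᵥ x := fun x => by
      refine (LinearMap.pi_apply_eq_sum_univ L.toLinearMap x).trans ?_
      simp only [dotProduct, a]
      refine Finset.sum_congr rfl fun i _ => ?_
      have e : (fun j => if i = j then (1 : ℝ) else 0) = Pi.single i 1 := by
        ext j; simp [Pi.single_apply, eq_comm]
      rw [e, smul_eq_mul, mul_comm]
      rfl
    have hint : ∀ {g : (ι → ℝ) → ℝ}, Integrable g →
        Integrable fun x => (ENNReal.ofReal (g x)).toReal • Complex.exp (L x * Complex.I) := by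
      intro g hg
      have := integrable_character_mul a (f := fun x => ((max (g x) 0 : ℝ) : ℂ)) hg.pos_part.ofReal
      refine this.congr (Filter.Eventually.of_forall fun x => ?_)
      simp only [hL, ENNReal.toReal_ofReal', Complex.real_smul]
      rw [mul_comm, mul_comm Complex.I]
    rw [← integral_sub (hint hu) (hint hu'), ← h a]
    congr 1
    funext x
    simp only [hL, ENNReal.toReal_ofReal', Complex.real_smul]
    rw [← sub_mul, ← Complex.ofReal_sub]
    have : max (u x) 0 - max (-u x) 0 = u x := by
      rcases le_total 0 (u x) with h0 | h0
      · rw [max_eq_left h0, max_eq_right (by linarith), sub_zero]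
      · rw [max_eq_right h0, max_eq_left (by linarith)]; ring
    rw [this, mul_comm, mul_comm Complex.I]
  have := (withDensity_eq_iff_of_sigmaFinite hu.aemeasurable.ennreal_ofReal
    hu'.aemeasurable.ennreal_ofReal).1 hμν
  filter_upwards [this] with x hx
  rcases le_total 0 (u x) with h0 | h0
  · rw [ENNReal.ofReal_of_nonpos (p := -u x) (by linarith), ENNReal.ofReal_eq_zero] at hx
    exact le_antisymm hx h0
  · rw [ENNReal.ofReal_of_nonpos h0, eq_comm, ENNReal.ofReal_eq_zero] at hx
    exact le_antisymm h0 (neg_nonpos.1 hx)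

/-- The Fourier transform is injective on integrable functions. -/
theorem ae_eq_zero_of_fourier_eq_zero {f : (ι → ℝ) → ℂ} (hf : Integrable f)
    (h : ∀ a : ι → ℝ, ∫ x, Complex.exp (Complex.I * ((a ⬝ᵥ x : ℝ) : ℂ)) * f x = 0) :
    f =ᵐ[volume] 0 := by
  have hc : Integrable fun x => (starRingEnd ℂ) (f x) :=
    (LinearIsometryEquiv.integrable_comp_iff Complex.conjLIE).2 hf
  have hconj : ∀ a : ι → ℝ,
      ∫ x, Complex.exp (Complex.I * ((a ⬝ᵥ x : ℝ) : ℂ)) * (starRingEnd ℂ) (f x) = 0 := by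
    intro a
    have := congrArg (starRingEnd ℂ) (h (-a))
    rw [← integral_conj, map_zero] at this
    rw [← this]
    congr 1
    funext x
    simp [← Complex.exp_conj]
  have hre : (fun x => (f x).re) =ᵐ[volume] 0 := by
    refine ae_eq_zero_of_fourier_eq_zero_real hf.re fun a => ?_
    have e : ∀ x, Complex.exp (Complex.I * ((a ⬝ᵥ x : ℝ) : ℂ)) * ((f x).re : ℂ) =
        (1 / 2 : ℂ) * (Complex.exp (Complex.I * ((a ⬝ᵥ x : ℝ) : ℂ)) * f x +
          Complex.exp (Complex.I * ((a ⬝ᵥ x : ℝ) : ℂ)) * (starRingEnd ℂ) (f x)) := fun x => by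
      rw [Complex.re_eq_add_conj]; ring
    simp_rw [e]
    rw [integral_const_mul, integral_add (integrable_character_mul a hf)
      (integrable_character_mul a hc), h, hconj]
    simp
  have him : (fun x => (f x).im) =ᵐ[volume] 0 := by
    refine ae_eq_zero_of_fourier_eq_zero_real hf.im fun a => ?_
    have e : ∀ x, Complex.exp (Complex.I * ((a ⬝ᵥ x : ℝ) : ℂ)) * ((f x).im : ℂ) =
        (1 / (2 * Complex.I) : ℂ) * (Complex.exp (Complex.I * ((a ⬝ᵥ x : ℝ) : ℂ)) * f x -
          Complex.exp (Complex.I * ((a ⬝ᵥ x : ℝ) : ℂ)) * (starRingEnd ℂ) (f x)) := fun x => by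
      rw [Complex.im_eq_sub_conj]; ring
    simp_rw [e]
    rw [integral_const_mul, integral_sub (integrable_character_mul a hf)
      (integrable_character_mul a hc), h, hconj]
    simp
  filter_upwards [hre, him] with x h1 h2
  exact Complex.ext h1 h2

end Fourier

/-! ### Weyl operators and the Weyl relations -/

section Weyl

variable {ι : Type*} [Fintype ι]

theorem coeFn_weyl (ξ : Phase ι) (ψ : Hilb ι) : weyl ξ ψ =ᵐ[volume] weylFun ξ ψ :=
  MemLp.coeFn_toLp _

theorem ae_comp_add_right {f g : (ι → ℝ) → ℂ} (h : f =ᵐ[volume] g) (b : ι → ℝ) :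
    (fun x => f (x + b)) =ᵐ[volume] fun x => g (x + b) :=
  (measurePreserving_add_right volume b).quasiMeasurePreserving.ae_eq_comp h

theorem weylFun_congr (ξ : Phase ι) {f g : (ι → ℝ) → ℂ} (h : f =ᵐ[volume] g) :
    weylFun ξ f =ᵐ[volume] weylFun ξ g := by
  filter_upwards [ae_comp_add_right h (momPart ξ)] with x hx
  simp only [weylFun, hx]

theorem weyl_add_right (ξ : Phase ι) (ψ φ : Hilb ι) : weyl ξ (ψ + φ) = weyl ξ ψ + weyl ξ φ := by
  apply Lp.ext
  filter_upwards [coeFn_weyl ξ (ψ + φ), Lp.coeFn_add (weyl ξ ψ) (weyl ξ φ), coeFn_weyl ξ ψ,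
    coeFn_weyl ξ φ, weylFun_congr ξ (Lp.coeFn_add ψ φ)] with x h1 h2 h3 h4 h5
  rw [h1, h2, h5, Pi.add_apply, h3, h4]
  simp [weylFun, mul_add]

theorem weyl_smul_right (ξ : Phase ι) (c : ℂ) (ψ : Hilb ι) : weyl ξ (c • ψ) = c • weyl ξ ψ := by
  apply Lp.ext
  filter_upwards [coeFn_weyl ξ (c • ψ), Lp.coeFn_smul c (weyl ξ ψ), coeFn_weyl ξ ψ,
    weylFun_congr ξ (Lp.coeFn_smul c ψ)] with x h1 h2 h3 h5
  rw [h1, h2, h5, Pi.smul_apply, h3]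
  simp [weylFun, mul_left_comm]

theorem weyl_zero (ψ : Hilb ι) : weyl 0 ψ = ψ := by
  apply Lp.ext
  filter_upwards [coeFn_weyl 0 ψ] with x h1
  rw [h1]
  have : momPart (0 : Phase ι) = 0 := rfl
  have h2 : posPart (0 : Phase ι) = 0 := rfl
  simp [weylFun, this, h2]

theorem norm_weyl (ξ : Phase ι) (ψ : Hilb ι) : ‖weyl ξ ψ‖ = ‖ψ‖ := by
  have h1 : ‖weyl ξ ψ‖ = (eLpNorm (weylFun ξ ψ) 2 volume).toReal := Lp.norm_toLp _ _
  rw [h1, Lp.norm_def, ← eLpNorm_comp_measurePreserving (Lp.aestronglyMeasurable ψ)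
    (measurePreserving_add_right volume (momPart ξ))]
  congr 1
  refine eLpNorm_congr_norm_ae (Filter.Eventually.of_forall fun x => ?_)
  rw [weylFun, norm_mul, norm_character, one_mul]
  rfl

variable [DecidableEq ι]

theorem dotProduct_J_mulVec (ξ η : Phase ι) :
    ξ ⬝ᵥ (J ι ℝ *ᵥ η) = posPart η ⬝ᵥ momPart ξ - posPart ξ ⬝ᵥ momPart η := by
  have h : J ι ℝ *ᵥ η = Sum.elim (-momPart η) (posPart η) := by
    have : η = Sum.elim (posPart η) (momPart η) := by ext (i | i) <;> rfl
    conv_lhs => rw [this, J, fromBlocks_mulVec]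
    simp [neg_mulVec, Function.comp_def]
  rw [h]
  simp only [dotProduct, Fintype.sum_sum_type, posPart, momPart, Sum.elim_inl, Sum.elim_inr,
    Pi.neg_apply, mul_neg, Finset.sum_neg_distrib]
  rw [neg_add_eq_sub]
  congr 1
  exact Finset.sum_congr rfl fun i _ => mul_comm _ _

/-- The Weyl relations. -/
theorem weyl_weyl (ξ η : Phase ι) (ψ : Hilb ι) :
    weyl ξ (weyl η ψ) =
      Complex.exp (Complex.I * ((ξ ⬝ᵥ (J ι ℝ *ᵥ η) / 2 : ℝ) : ℂ)) • weyl (ξ + η) ψ := by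
  apply Lp.ext
  filter_upwards [coeFn_weyl ξ (weyl η ψ), Lp.coeFn_smul
    (Complex.exp (Complex.I * ((ξ ⬝ᵥ (J ι ℝ *ᵥ η) / 2 : ℝ) : ℂ))) (weyl (ξ + η) ψ),
    coeFn_weyl (ξ + η) ψ, weylFun_congr ξ (coeFn_weyl η ψ)] with x h1 h2 h3 h4
  rw [h1, h2, h4, Pi.smul_apply, h3, dotProduct_J_mulVec]
  have e1 : momPart (ξ + η) = momPart ξ + momPart η := rfl
  have e2 : posPart (ξ + η) = posPart ξ + posPart η := rfl
  simp only [weylFun, e1, e2, smul_eq_mul, ← mul_assoc, ← Complex.exp_add]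
  congr 2
  · rw [← mul_add, ← mul_add, ← Complex.ofReal_add, ← Complex.ofReal_add]
    congr 2
    simp only [add_dotProduct, dotProduct_add]
    ring
  · rw [add_assoc]

theorem weyl_neg_weyl (ξ : Phase ι) (ψ : Hilb ι) : weyl (-ξ) (weyl ξ ψ) = ψ := by
  rw [weyl_weyl, neg_add_cancel, weyl_zero, neg_dotProduct, J_mulVec_dotProduct_self]
  simp

/-- The Weyl operators as unitaries. -/
def weylEquiv (ξ : Phase ι) : Hilb ι ≃ₗᵢ[ℂ] Hilb ι where
  toFun := weyl ξ
  map_add' := weyl_add_right ξ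
  map_smul' := weyl_smul_right ξ
  invFun := weyl (-ξ)
  left_inv := weyl_neg_weyl ξ
  right_inv ψ := by simpa using weyl_neg_weyl (-ξ) ψ
  norm_map' := norm_weyl ξ

@[simp] theorem weylEquiv_apply (ξ : Phase ι) (ψ : Hilb ι) : weylEquiv ξ ψ = weyl ξ ψ := rfl

@[simp] theorem weylEquiv_symm_apply (ξ : Phase ι) (ψ : Hilb ι) :
    (weylEquiv ξ).symm ψ = weyl (-ξ) ψ := rfl

theorem inner_weyl_left (ξ : Phase ι) (ψ φ : Hilb ι) :
    inner ℂ (weyl ξ ψ) φ = inner ℂ ψ (weyl (-ξ) φ) := by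
  rw [← weylEquiv_apply, ← weylEquiv_symm_apply, LinearIsometryEquiv.inner_map_eq_flip]

/-- For `φ = ψ` the Gram matrix of the Weyl orbit depends only on the symplectic form and the
characteristic function. -/
theorem inner_weyl_weyl (ξ η : Phase ι) (ψ φ : Hilb ι) :
    inner ℂ (weyl ξ ψ) (weyl η φ) =
      Complex.exp (-(Complex.I * ((ξ ⬝ᵥ (J ι ℝ *ᵥ η) / 2 : ℝ) : ℂ))) *
        inner ℂ ψ (weyl (η - ξ) φ) := by
  rw [inner_weyl_left, weyl_weyl, inner_smul_right, neg_add_eq_sub, neg_dotProduct]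
  congr 2
  push_cast
  ring

end Weyl

/-! ### Moments and energy from the characteristic function -/

section Moments

open Filter Topology

/-- In `‖f s - f t‖² = ‖f s‖² + ‖f t‖² - 2 Re ⟨f s, f t⟩` the right side tends to `2 Re K - 2 Re K =
0`, so `f` is Cauchy along `l`. -/
theorem exists_tendsto_of_tendsto_inner {E α : Type*} [NormedAddCommGroup E]
    [InnerProductSpace ℂ E] [CompleteSpace E] {l : Filter α} [l.NeBot] {f : α → E} {K : ℂ}
    (hK : Tendsto (fun p : α × α => inner ℂ (f p.1) (f p.2)) (l ×ˢ l) (𝓝 K)) :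
    ∃ φ, Tendsto f l (𝓝 φ) := by
  refine cauchy_map_iff_exists_tendsto.1 (cauchy_map_iff.2 ⟨inferInstance, ?_⟩)
  rw [tendsto_uniformity_iff_dist_tendsto_zero]
  have hdiag : Tendsto (fun t => inner ℂ (f t) (f t)) l (𝓝 K) :=
    hK.comp (tendsto_id.prodMk tendsto_id)
  have h1 := hdiag.comp (tendsto_fst (f := l) (g := l))
  have h2 := hdiag.comp (tendsto_snd (f := l) (g := l))
  have h3 := (Complex.continuous_re.tendsto _).comp (h1.add h2)
  have h4 := ((Complex.continuous_re.tendsto _).comp hK).const_mul 2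
  have h5 := h3.sub h4
  have h6 : Tendsto (fun p : α × α => dist (f p.1) (f p.2) ^ 2) (l ×ˢ l) (𝓝 0) := by
    have e : (K + K).re - 2 * K.re = 0 := by rw [Complex.add_re]; ring
    rw [e] at h5
    refine h5.congr fun p => ?_
    simp only [Function.comp_apply]
    rw [dist_eq_norm, @norm_sub_sq ℂ, Complex.add_re, @norm_sq_eq_re_inner ℂ _ _ _ _ (f p.1),
      @norm_sq_eq_re_inner ℂ _ _ _ _ (f p.2)]
    simp only [RCLike.re_to_complex]
    ring
  have h7 := (Real.continuous_sqrt.tendsto 0).comp h6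
  rw [Real.sqrt_zero] at h7
  refine h7.congr fun p => ?_
  simp only [Function.comp_apply]
  exact Real.sqrt_sq dist_nonneg

variable {ι : Type*} [Fintype ι]

/-- The state `|ψ⟩⟨ψ|` is Gaussian with mean `d` and symmetric matrix `C`. -/
structure GaussianWith (ψ : Hilb ι) (d : Phase ι) (C : Matrix (ι ⊕ ι) (ι ⊕ ι) ℝ) : Prop where
  norm_eq : ‖ψ‖ = 1
  symm : C.IsSymm
  char_eq : ∀ ξ : Phase ι, inner ℂ ψ (weyl ξ ψ) =
    Complex.exp (Complex.I * ((ξ ⬝ᵥ d : ℝ) : ℂ) - ((ξ ⬝ᵥ (C *ᵥ ξ) : ℝ) : ℂ) / 4)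

/-- The characteristic function sees only the symmetric part of `C`, so `C` may be symmetrized; only
then can it be the covariance matrix. -/
theorem IsPureGaussian.exists_gaussianWith {ψ : Hilb ι} (h : IsPureGaussian ψ) :
    ∃ d C, GaussianWith ψ d C := by
  obtain ⟨h1, d, C, h2⟩ := h
  refine ⟨d, (1 / 2 : ℝ) • (C + Cᵀ), h1, ?_, fun ξ => ?_⟩
  · rw [IsSymm, transpose_smul, transpose_add, transpose_transpose, add_comm]
  · rw [h2]
    have : ξ ⬝ᵥ (((1 / 2 : ℝ) • (C + Cᵀ)) *ᵥ ξ) = ξ ⬝ᵥ (C *ᵥ ξ) := by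
      have e : ξ ⬝ᵥ (Cᵀ *ᵥ ξ) = ξ ⬝ᵥ (C *ᵥ ξ) := by
        rw [mulVec_transpose, dotProduct_comm, dotProduct_mulVec]
      rw [smul_mulVec, add_mulVec, dotProduct_smul, dotProduct_add, e, smul_eq_mul]
      ring
    rw [this]

theorem GaussianWith.inner_self {ψ : Hilb ι} {d : Phase ι} {C : Matrix (ι ⊕ ι) (ι ⊕ ι) ℝ}
    (h : GaussianWith ψ d C) : inner ℂ ψ ψ = 1 := by
  rw [inner_self_eq_norm_sq_to_K, h.norm_eq]; simp

/-- The difference quotient at `0` of the orbit `t ↦ W(t ξ) ψ`. -/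
def diffQuot (ψ : Hilb ι) (ξ : Phase ι) (t : ℝ) : Hilb ι :=
  ((t : ℂ)⁻¹) • (weyl (t • ξ) ψ - ψ)

theorem slope_weyl (ψ : Hilb ι) (ξ : Phase ι) :
    slope (fun t : ℝ => weyl (t • ξ) ψ) 0 = diffQuot ψ ξ := by
  funext t
  rw [slope_def_module, diffQuot, zero_smul, weyl_zero, sub_zero]
  rw [← Complex.ofReal_inv, Complex.coe_smul]
  rfl

theorem tendsto_gaussian_slope (α β : ℝ) :
    Tendsto (fun t : ℝ => (t : ℂ)⁻¹ *
      (Complex.exp (Complex.I * ((t * α : ℝ) : ℂ) - ((t * (t * β) : ℝ) : ℂ) / 4) - 1))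
      (𝓝[≠] 0) (𝓝 (Complex.I * α)) := by
  have h : HasDerivAt (fun t : ℝ =>
      Complex.exp (Complex.I * ((t * α : ℝ) : ℂ) - ((t * (t * β) : ℝ) : ℂ) / 4))
      (Complex.I * α) 0 := by
    have h1 : HasDerivAt (fun t : ℝ => ((t * α : ℝ) : ℂ)) ((1 * α : ℝ) : ℂ) 0 :=
      ((hasDerivAt_id (0 : ℝ)).mul_const α).ofReal_comp
    have h2 : HasDerivAt (fun t : ℝ => ((t * (t * β) : ℝ) : ℂ))
        ((1 * (0 * β) + 0 * (1 * β) : ℝ) : ℂ) 0 :=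
      ((hasDerivAt_id (0 : ℝ)).mul ((hasDerivAt_id (0 : ℝ)).mul_const β)).ofReal_comp
    have h3 := ((h1.const_mul Complex.I).fun_sub (h2.div_const 4)).cexp
    convert h3 using 1
    simp
  have := hasDerivAt_iff_tendsto_slope.1 h
  refine this.congr fun t => ?_
  rw [slope_def_module]
  simp

theorem tendsto_exp_slope (w : ℂ) :
    Tendsto (fun t : ℝ => (t : ℂ)⁻¹ * (Complex.exp (t * w) - 1)) (𝓝[≠] 0) (𝓝 w) := by
  have h : HasDerivAt (fun t : ℝ => Complex.exp ((t : ℂ) * w)) w 0 := by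
    have h1 : HasDerivAt (fun t : ℝ => (t : ℂ)) ((1 : ℝ) : ℂ) 0 :=
      (hasDerivAt_id (0 : ℝ)).ofReal_comp
    convert (h1.mul_const w).cexp using 1
    simp
  refine (hasDerivAt_iff_tendsto_slope.1 h).congr fun t => ?_
  rw [slope_def_module]
  simp

theorem GaussianWith.tendsto_inner_weyl_slope {ψ : Hilb ι} {d : Phase ι}
    {C : Matrix (ι ⊕ ι) (ι ⊕ ι) ℝ} (h : GaussianWith ψ d C) (ξ : Phase ι) :
    Tendsto (fun t : ℝ => (t : ℂ)⁻¹ * (inner ℂ ψ (weyl (t • ξ) ψ) - 1)) (𝓝[≠] 0)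
      (𝓝 (Complex.I * ((ξ ⬝ᵥ d : ℝ) : ℂ))) := by
  refine (tendsto_gaussian_slope (ξ ⬝ᵥ d) (ξ ⬝ᵥ (C *ᵥ ξ))).congr fun t => ?_
  rw [h.char_eq]
  simp only [smul_dotProduct, dotProduct_smul, mulVec_smul, smul_eq_mul]

theorem GaussianWith.tendsto_inner_weyl {ψ : Hilb ι} {d : Phase ι}
    {C : Matrix (ι ⊕ ι) (ι ⊕ ι) ℝ} (h : GaussianWith ψ d C) (ξ : Phase ι) :
    Tendsto (fun t : ℝ => inner ℂ ψ (weyl (t • ξ) ψ)) (𝓝[≠] 0) (𝓝 1) := by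
  have hc : Continuous fun t : ℝ => inner ℂ ψ (weyl (t • ξ) ψ) := by
    simp only [h.char_eq, smul_dotProduct, dotProduct_smul, mulVec_smul, smul_eq_mul]
    fun_prop
  have := hc.tendsto 0
  rw [zero_smul, weyl_zero, h.inner_self] at this
  exact this.mono_left nhdsWithin_le_nhds

variable [DecidableEq ι]

/-- The second moment `⟨R_ξ ψ, R_η ψ⟩` of a Gaussian state. -/
def secondMoment (d : Phase ι) (C : Matrix (ι ⊕ ι) (ι ⊕ ι) ℝ) (ξ η : Phase ι) : ℂ :=
  ((ξ ⬝ᵥ d : ℝ) : ℂ) * ((η ⬝ᵥ d : ℝ) : ℂ) + ((ξ ⬝ᵥ (C *ᵥ η) / 2 : ℝ) : ℂ)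
    - Complex.I * ((ξ ⬝ᵥ (J ι ℝ *ᵥ η) / 2 : ℝ) : ℂ)

variable {ψ : Hilb ι} {d : Phase ι} {C : Matrix (ι ⊕ ι) (ι ⊕ ι) ℝ}

/-- The Gram entry of the orbit is the product of the two single characteristic values and an
exponential linear in `t s`. Each factor then contributes its own difference quotient, with known
limit. -/
theorem GaussianWith.inner_diffQuot (h : GaussianWith ψ d C) (ξ η : Phase ι) {t s : ℝ}
    (ht : t ≠ 0) (hs : s ≠ 0) :
    inner ℂ (diffQuot ψ ξ t) (diffQuot ψ η s) =
      ((s : ℂ)⁻¹ * (inner ℂ ψ (weyl (s • η) ψ) - 1)) *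
        ((t : ℂ)⁻¹ * (inner ℂ ψ (weyl (t • -ξ) ψ) - 1)) +
      inner ℂ ψ (weyl (s • η) ψ) * inner ℂ ψ (weyl (t • -ξ) ψ) *
        (((t * s : ℝ) : ℂ)⁻¹ * (Complex.exp (((t * s : ℝ) : ℂ) *
          (((ξ ⬝ᵥ (C *ᵥ η) / 2 : ℝ) : ℂ) - Complex.I * ((ξ ⬝ᵥ (J ι ℝ *ᵥ η) / 2 : ℝ) : ℂ))) - 1)) := by
  have hsym : η ⬝ᵥ (C *ᵥ ξ) = ξ ⬝ᵥ (C *ᵥ η) := by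
    rw [dotProduct_mulVec, ← mulVec_transpose, h.symm.eq, dotProduct_comm]
  have key : inner ℂ (weyl (t • ξ) ψ) (weyl (s • η) ψ) =
      inner ℂ ψ (weyl (s • η) ψ) * inner ℂ ψ (weyl (t • -ξ) ψ) *
      Complex.exp (((t * s : ℝ) : ℂ) *
          (((ξ ⬝ᵥ (C *ᵥ η) / 2 : ℝ) : ℂ) - Complex.I * ((ξ ⬝ᵥ (J ι ℝ *ᵥ η) / 2 : ℝ) : ℂ))) := by
    rw [inner_weyl_weyl, h.char_eq, h.char_eq, h.char_eq, ← Complex.exp_add, ← Complex.exp_add,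
      ← Complex.exp_add]
    congr 1
    simp only [mulVec_sub, sub_dotProduct, dotProduct_sub, smul_dotProduct, dotProduct_smul,
      mulVec_smul, smul_eq_mul, hsym, smul_neg, mulVec_neg, neg_dotProduct, dotProduct_neg]
    push_cast
    ring
  have hl : inner ℂ (weyl (t • ξ) ψ) ψ = inner ℂ ψ (weyl (t • -ξ) ψ) := by
    rw [inner_weyl_left, smul_neg]
  have ht' : (t : ℂ) ≠ 0 := by exact_mod_cast ht
  have hs' : (s : ℂ) ≠ 0 := by exact_mod_cast hs
  rw [diffQuot, diffQuot, inner_smul_left, inner_smul_right, inner_sub_left, inner_sub_right,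
    inner_sub_right, key, hl, h.inner_self, map_inv₀, Complex.conj_ofReal]
  push_cast
  field_simp
  ring

/-- The limit is joint in independent `t` and `s`. The case `ξ = η` therefore gives the Cauchy
property, hence differentiability of the orbit, and the general case gives the second moments. -/
theorem GaussianWith.tendsto_inner_diffQuot (h : GaussianWith ψ d C) (ξ η : Phase ι) :
    Tendsto (fun p : ℝ × ℝ => inner ℂ (diffQuot ψ ξ p.1) (diffQuot ψ η p.2))
      (𝓝[≠] 0 ×ˢ 𝓝[≠] 0) (𝓝 (secondMoment d C ξ η)) := by
  have hprod : Tendsto (fun p : ℝ × ℝ => p.1 * p.2) (𝓝[≠] 0 ×ˢ 𝓝[≠] 0) (𝓝[≠] 0) := by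
    rw [tendsto_nhdsWithin_iff]
    constructor
    · have : Tendsto (fun p : ℝ × ℝ => p.1 * p.2) (𝓝 0 ×ˢ 𝓝 0) (𝓝 (0 * 0)) := by
        rw [← nhds_prod_eq]; exact (continuous_fst.mul continuous_snd).tendsto _
      rw [mul_zero] at this
      exact this.mono_left (Filter.prod_mono nhdsWithin_le_nhds nhdsWithin_le_nhds)
    · filter_upwards [prod_mem_prod self_mem_nhdsWithin self_mem_nhdsWithin] with p hp
      exact mul_ne_zero hp.1 hp.2
  have h1 := (h.tendsto_inner_weyl_slope η).comp
    (tendsto_snd (f := 𝓝[≠] (0 : ℝ)) (g := 𝓝[≠] (0 : ℝ)))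
  have h2 := (h.tendsto_inner_weyl_slope (-ξ)).comp
    (tendsto_fst (f := 𝓝[≠] (0 : ℝ)) (g := 𝓝[≠] (0 : ℝ)))
  have h3 := (h.tendsto_inner_weyl η).comp
    (tendsto_snd (f := 𝓝[≠] (0 : ℝ)) (g := 𝓝[≠] (0 : ℝ)))
  have h4 := (h.tendsto_inner_weyl (-ξ)).comp
    (tendsto_fst (f := 𝓝[≠] (0 : ℝ)) (g := 𝓝[≠] (0 : ℝ)))
  have h5 := (tendsto_exp_slope (((ξ ⬝ᵥ (C *ᵥ η) / 2 : ℝ) : ℂ) -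
    Complex.I * ((ξ ⬝ᵥ (J ι ℝ *ᵥ η) / 2 : ℝ) : ℂ))).comp hprod
  have h6 := (h1.mul h2).add ((h3.mul h4).mul h5)
  have hval : Complex.I * ((η ⬝ᵥ d : ℝ) : ℂ) * (Complex.I * ((-ξ ⬝ᵥ d : ℝ) : ℂ)) + 1 * 1 *
      (((ξ ⬝ᵥ (C *ᵥ η) / 2 : ℝ) : ℂ) - Complex.I * ((ξ ⬝ᵥ (J ι ℝ *ᵥ η) / 2 : ℝ) : ℂ))
      = secondMoment d C ξ η := by
    rw [secondMoment, neg_dotProduct, Complex.ofReal_neg]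
    linear_combination (-((ξ ⬝ᵥ d : ℝ) : ℂ) * ((η ⬝ᵥ d : ℝ) : ℂ)) * Complex.I_sq
  rw [hval] at h6
  refine h6.congr' ?_
  filter_upwards [prod_mem_prod self_mem_nhdsWithin self_mem_nhdsWithin] with p hp
  exact (h.inner_diffQuot ξ η hp.1 hp.2).symm

theorem GaussianWith.exists_tendsto_diffQuot (h : GaussianWith ψ d C) (ξ : Phase ι) :
    ∃ φ : Hilb ι, Tendsto (diffQuot ψ ξ) (𝓝[≠] 0) (𝓝 φ) := by
  exact exists_tendsto_of_tendsto_inner (h.tendsto_inner_diffQuot ξ ξ)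

/-- The derivative at `0` of the orbit `t ↦ W(t ξ) ψ` (formally `i R_ξ ψ`). -/
def orbitDeriv (ψ : Hilb ι) (ξ : Phase ι) : Hilb ι := deriv (fun t : ℝ => weyl (t • ξ) ψ) 0

theorem GaussianWith.differentiableAt (h : GaussianWith ψ d C) (ξ : Phase ι) :
    DifferentiableAt ℝ (fun t : ℝ => weyl (t • ξ) ψ) 0 := by
  obtain ⟨φ, hφ⟩ := h.exists_tendsto_diffQuot ξ
  rw [← slope_weyl] at hφ
  exact (hasDerivAt_iff_tendsto_slope.2 hφ).differentiableAt

theorem GaussianWith.tendsto_diffQuot (h : GaussianWith ψ d C) (ξ : Phase ι) :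
    Tendsto (diffQuot ψ ξ) (𝓝[≠] 0) (𝓝 (orbitDeriv ψ ξ)) := by
  rw [← slope_weyl]
  exact hasDerivAt_iff_tendsto_slope.1 (h.differentiableAt ξ).hasDerivAt

theorem GaussianWith.inner_orbitDeriv (h : GaussianWith ψ d C) (ξ η : Phase ι) :
    inner ℂ (orbitDeriv ψ ξ) (orbitDeriv ψ η) = secondMoment d C ξ η :=
  tendsto_nhds_unique (((h.tendsto_diffQuot ξ).comp tendsto_fst).inner
    ((h.tendsto_diffQuot η).comp tendsto_snd)) (h.tendsto_inner_diffQuot ξ η)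

theorem GaussianWith.inner_self_orbitDeriv (h : GaussianWith ψ d C) (ξ : Phase ι) :
    inner ℂ ψ (orbitDeriv ψ ξ) = Complex.I * ((ξ ⬝ᵥ d : ℝ) : ℂ) := by
  refine tendsto_nhds_unique (tendsto_const_nhds.inner (h.tendsto_diffQuot ξ)) ?_
  refine (h.tendsto_inner_weyl_slope ξ).congr fun t => ?_
  rw [diffQuot, inner_smul_right, inner_sub_right, h.inner_self]

theorem basisVec_dotProduct (k : ι ⊕ ι) (v : Phase ι) : basisVec k ⬝ᵥ v = v k := by
  simp [basisVec]

theorem mulVec_basisVec (M : Matrix (ι ⊕ ι) (ι ⊕ ι) ℝ) (k l : ι ⊕ ι) :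
    basisVec k ⬝ᵥ (M *ᵥ basisVec l) = M k l := by
  simp [basisVec]

theorem GaussianWith.inner_quad (h : GaussianWith ψ d C) (k l : ι ⊕ ι) :
    inner ℂ (quad k ψ) (quad l ψ) =
      (d k : ℂ) * d l + ((C k l / 2 : ℝ) : ℂ) - Complex.I * ((J ι ℝ k l / 2 : ℝ) : ℂ) := by
  have h1 := h.inner_orbitDeriv (basisVec k) (basisVec l)
  simp only [secondMoment, mulVec_basisVec] at h1
  simp only [basisVec_dotProduct] at h1
  rw [← h1, quad, quad, inner_smul_left, inner_smul_right, ← mul_assoc]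
  simp [orbitDeriv]

theorem GaussianWith.firstMoment_eq (h : GaussianWith ψ d C) : firstMoment ψ = d := by
  funext k
  have h1 := h.inner_self_orbitDeriv (basisVec k)
  rw [basisVec_dotProduct] at h1
  rw [firstMoment, quad, inner_smul_right]
  change (-Complex.I * inner ℂ ψ (orbitDeriv ψ (basisVec k))).re = _
  rw [h1]
  simp

theorem GaussianWith.covMatrix_eq (h : GaussianWith ψ d C) : covMatrix ψ = C := by
  ext k l
  rw [covMatrix, Matrix.of_apply, h.firstMoment_eq, h.inner_quad, h.inner_quad]
  have h1 : C l k = C k l := h.symm.apply k l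
  simp [h1]
  ring

theorem GaussianWith.energy_eq (h : GaussianWith ψ d C) :
    energy ψ = ENNReal.ofReal (C.trace / 4 + d ⬝ᵥ d / 2) := by
  have hdom : ∀ k, InDomain k ψ := fun k => h.differentiableAt (basisVec k)
  rw [energy, if_pos hdom]
  congr 1
  have h1 : ∀ k, ‖quad k ψ‖ ^ 2 = d k * d k + C k k / 2 := fun k => by
    rw [@norm_sq_eq_re_inner ℂ, h.inner_quad]
    simp
  simp only [h1, Finset.sum_add_distrib, dotProduct, Matrix.trace, Matrix.diag_apply,
    ← Finset.sum_div]
  ring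

/-- The centred vector `φ`, formally `i (R_ξ - ⟨R_ξ⟩) ψ`, has squared norm `ξ·Cξ / 2`. It cannot
vanish for `ξ ≠ 0`, because its inner products with the other orbit derivatives carry the commutator
as imaginary part. -/
theorem GaussianWith.posDef (h : GaussianWith ψ d C) : C.PosDef := by
  refine Matrix.PosDef.of_dotProduct_mulVec_pos (by simpa using h.symm) fun ξ hξ => ?_
  rw [star_trivial]
  set φ := orbitDeriv ψ ξ - (Complex.I * ((ξ ⬝ᵥ d : ℝ) : ℂ)) • ψ with hφ
  have hin : ∀ η, inner ℂ φ (orbitDeriv ψ η) =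
      ((ξ ⬝ᵥ (C *ᵥ η) / 2 : ℝ) : ℂ) - Complex.I * ((ξ ⬝ᵥ (J ι ℝ *ᵥ η) / 2 : ℝ) : ℂ) := fun η => by
    rw [hφ, inner_sub_left, inner_smul_left, h.inner_orbitDeriv, h.inner_self_orbitDeriv,
      secondMoment, map_mul, Complex.conj_I, Complex.conj_ofReal]
    linear_combination (((ξ ⬝ᵥ d : ℝ) : ℂ) * ((η ⬝ᵥ d : ℝ) : ℂ)) * Complex.I_sq
  have hψ : inner ℂ φ ψ = 0 := by
    have := congrArg (starRingEnd ℂ) (h.inner_self_orbitDeriv ξ)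
    rw [inner_conj_symm] at this
    rw [hφ, inner_sub_left, inner_smul_left, this, h.inner_self]
    simp
  have hnorm : ‖φ‖ ^ 2 = ξ ⬝ᵥ (C *ᵥ ξ) / 2 := by
    have e : inner ℂ φ φ = ((ξ ⬝ᵥ (C *ᵥ ξ) / 2 : ℝ) : ℂ) := by
      conv_lhs => rw [hφ]
      rw [← hφ, inner_sub_right, inner_smul_right, hψ, hin, J_mulVec_dotProduct_self]
      simp
    rw [@norm_sq_eq_re_inner ℂ, e]
    simp
  have hne : φ ≠ 0 := by
    intro h0
    apply hξ
    have hJ : ∀ η, ξ ⬝ᵥ (J ι ℝ *ᵥ η) = 0 := fun η => by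
      have := congrArg Complex.im (hin η)
      rw [h0, inner_zero_left] at this
      simpa using this
    -- The choice `η = J ξ` turns the symplectic form into `-|ξ|²`.
    have := hJ (J ι ℝ *ᵥ ξ)
    rw [mulVec_mulVec, J_squared, neg_mulVec, one_mulVec, dotProduct_neg, neg_eq_zero] at this
    exact dotProduct_self_eq_zero.1 this
  have : 0 < ‖φ‖ ^ 2 := by positivity
  linarith

end Moments

/-! ### Explicit Gaussian wave functions -/

section GaussianVectors

variable {ι : Type*} [Fintype ι] [DecidableEq ι]

theorem integral_cexp_neg_dotProduct_self {ι : Type*} [Fintype ι] (w : ι → ℝ) :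
    ∫ y : ι → ℝ, Complex.exp (-((y ⬝ᵥ y : ℝ) : ℂ) + Complex.I * ((w ⬝ᵥ y : ℝ) : ℂ)) =
      ((Real.pi ^ (Fintype.card ι / 2 : ℝ) : ℝ) : ℂ) * Complex.exp (-((w ⬝ᵥ w : ℝ) : ℂ) / 4) := by
  have h := GaussianFourier.integral_cexp_neg_mul_sum_add (b := 1) (by simp)
    (fun i => Complex.I * (w i : ℂ))
  rw [div_one] at h
  rw [Complex.ofReal_cpow Real.pi_pos.le]
  push_cast
  convert h using 2
  · funext y
    congr 1
    simp only [dotProduct, Complex.ofReal_sum, Complex.ofReal_mul, Finset.mul_sum]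
    congr 1
    · simp [sq]
    · exact Finset.sum_congr rfl fun i _ => by ring
  · congr 1
    simp only [dotProduct, Complex.ofReal_sum, Complex.ofReal_mul, mul_pow, Complex.I_sq, mul_one]
    congr 1
    rw [← Finset.sum_neg_distrib]
    exact Finset.sum_congr rfl fun i _ => by ring

theorem integral_comp_inv_mulVec {K : Matrix ι ι ℝ} (hK : IsUnit K.det) {f : (ι → ℝ) → ℂ}
    (hf : Continuous f) : ∫ x, f (K⁻¹ *ᵥ x) = ((|K.det| : ℝ) : ℂ) * ∫ x, f x := by
  have hK' : (K⁻¹).det ≠ 0 := by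
    rw [det_nonsing_inv]; exact (hK.ringInverse).ne_zero
  have hmap := Real.map_matrix_volume_pi_eq_smul_volume_pi hK'
  have hc : Continuous (toLin' K⁻¹) := LinearMap.continuous_of_finiteDimensional _
  have h1 : ∫ x, f (K⁻¹ *ᵥ x) = ∫ y, f y ∂(Measure.map (toLin' K⁻¹) volume) := by
    rw [integral_map hc.aemeasurable hf.aestronglyMeasurable]
    simp
  rw [h1, hmap, integral_smul_measure, det_nonsing_inv, ENNReal.toReal_ofReal (abs_nonneg _),
    Ring.inverse_eq_inv', inv_inv]
  rw [Complex.real_smul]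

/-- The normalization constant of `gaussFun`. -/
def gaussConst (K : Matrix ι ι ℝ) : ℝ :=
  Real.sqrt ((|K.det| * Real.pi ^ (Fintype.card ι / 2 : ℝ))⁻¹)

theorem gaussConst_pos {K : Matrix ι ι ℝ} (hK : IsUnit K.det) : 0 < gaussConst K := by
  have := hK.ne_zero
  have := Real.pi_pos
  unfold gaussConst
  positivity

theorem continuous_quadratic {ι : Type*} [Fintype ι] (M : Matrix ι ι ℝ) : Continuous fun x : ι → ℝ => x ⬝ᵥ (M *ᵥ x) :=
  continuous_id.dotProduct (continuous_const.matrix_mulVec continuous_id)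

theorem continuous_inv_sq (K : Matrix ι ι ℝ) :
    Continuous fun x : ι → ℝ => (K⁻¹ *ᵥ x) ⬝ᵥ (K⁻¹ *ᵥ x) :=
  (continuous_const.matrix_mulVec continuous_id).dotProduct
    (continuous_const.matrix_mulVec continuous_id)

theorem integral_gaussian {K : Matrix ι ι ℝ} (hK : IsUnit K.det) (w : ι → ℝ) :
    ∫ x : ι → ℝ, Complex.exp (Complex.I * ((w ⬝ᵥ x : ℝ) : ℂ)) *
        ((gaussConst K ^ 2 * Real.exp (-((K⁻¹ *ᵥ x) ⬝ᵥ (K⁻¹ *ᵥ x))) : ℝ) : ℂ) =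
      Complex.exp (-(((Kᵀ *ᵥ w) ⬝ᵥ (Kᵀ *ᵥ w) : ℝ) : ℂ) / 4) := by
  have hpos : 0 < |K.det| * Real.pi ^ (Fintype.card ι / 2 : ℝ) := by
    have := hK.ne_zero
    have := Real.pi_pos
    positivity
  have hcont : Continuous fun y : ι → ℝ => Complex.exp (-((y ⬝ᵥ y : ℝ) : ℂ) +
      Complex.I * (((Kᵀ *ᵥ w) ⬝ᵥ y : ℝ) : ℂ)) := by
    have h1 : Continuous fun y : ι → ℝ => y ⬝ᵥ y := continuous_id.dotProduct continuous_id
    have h2 : Continuous fun y : ι → ℝ => (Kᵀ *ᵥ w) ⬝ᵥ y :=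
      continuous_const.dotProduct continuous_id
    fun_prop
  have h := integral_comp_inv_mulVec hK hcont
  rw [integral_cexp_neg_dotProduct_self] at h
  have e : ∀ x : ι → ℝ, Complex.exp (Complex.I * ((w ⬝ᵥ x : ℝ) : ℂ)) *
      ((gaussConst K ^ 2 * Real.exp (-((K⁻¹ *ᵥ x) ⬝ᵥ (K⁻¹ *ᵥ x))) : ℝ) : ℂ) =
      ((gaussConst K ^ 2 : ℝ) : ℂ) * Complex.exp (-(((K⁻¹ *ᵥ x) ⬝ᵥ (K⁻¹ *ᵥ x) : ℝ) : ℂ) +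
        Complex.I * (((Kᵀ *ᵥ w) ⬝ᵥ (K⁻¹ *ᵥ x) : ℝ) : ℂ)) := fun x => by
    have : (Kᵀ *ᵥ w) ⬝ᵥ (K⁻¹ *ᵥ x) = w ⬝ᵥ x := by
      rw [mulVec_transpose, ← dotProduct_mulVec, mulVec_mulVec, mul_nonsing_inv _ hK, one_mulVec]
    rw [this, Complex.exp_add]
    push_cast
    ring
  simp_rw [e]
  rw [integral_const_mul, h, gaussConst, Real.sq_sqrt (inv_pos.2 hpos).le, ← mul_assoc, ← mul_assoc,
    mul_assoc ((_ : ℝ) : ℂ), ← Complex.ofReal_mul, ← Complex.ofReal_mul, inv_mul_cancel₀ hpos.ne']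
  simp

/-- The Gaussian wave function `x ↦ c exp (-|K⁻¹ x|²/2 - i x·Xx/2)`. -/
def gaussFun (K X : Matrix ι ι ℝ) (x : ι → ℝ) : ℂ :=
  (gaussConst K : ℂ) * Complex.exp (-(((K⁻¹ *ᵥ x) ⬝ᵥ (K⁻¹ *ᵥ x) / 2 : ℝ) : ℂ)
    - Complex.I * ((x ⬝ᵥ (X *ᵥ x) / 2 : ℝ) : ℂ))

theorem continuous_gaussFun (K X : Matrix ι ι ℝ) : Continuous (gaussFun K X) := by
  have h1 := continuous_quadratic X
  have h2 := continuous_inv_sq K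
  unfold gaussFun
  fun_prop

theorem norm_gaussFun_sq (K X : Matrix ι ι ℝ) (x : ι → ℝ) :
    ‖gaussFun K X x‖ ^ 2 = gaussConst K ^ 2 * Real.exp (-((K⁻¹ *ᵥ x) ⬝ᵥ (K⁻¹ *ᵥ x))) := by
  rw [gaussFun, norm_mul, mul_pow, Complex.norm_exp, ← Real.exp_nat_mul, Complex.norm_real,
    Real.norm_eq_abs, sq_abs]
  congr 2
  simp
  ring

theorem gaussFun_ne_zero {K : Matrix ι ι ℝ} (hK : IsUnit K.det) (X : Matrix ι ι ℝ) (x : ι → ℝ) :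
    gaussFun K X x ≠ 0 :=
  mul_ne_zero (Complex.ofReal_ne_zero.2 (gaussConst_pos hK).ne') (Complex.exp_ne_zero _)

theorem integrable_gaussian {K : Matrix ι ι ℝ} (hK : IsUnit K.det) :
    Integrable fun x : ι → ℝ =>
      gaussConst K ^ 2 * Real.exp (-((K⁻¹ *ᵥ x) ⬝ᵥ (K⁻¹ *ᵥ x))) := by
  have h := integral_gaussian hK 0
  have h1 : Integrable fun x : ι → ℝ =>
      ((gaussConst K ^ 2 * Real.exp (-((K⁻¹ *ᵥ x) ⬝ᵥ (K⁻¹ *ᵥ x))) : ℝ) : ℂ) := by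
    refine Integrable.of_integral_ne_zero ?_
    simp only [zero_dotProduct, Complex.ofReal_zero, mul_zero, Complex.exp_zero, one_mul] at h
    rw [h]
    exact Complex.exp_ne_zero _
  exact h1.re

theorem memLp_gaussFun {K : Matrix ι ι ℝ} (hK : IsUnit K.det) (X : Matrix ι ι ℝ) :
    MemLp (gaussFun K X) 2 volume := by
  rw [memLp_two_iff_integrable_sq_norm (continuous_gaussFun K X).aestronglyMeasurable]
  simp_rw [norm_gaussFun_sq]
  exact integrable_gaussian hK

/-- The unit vector with wave function `gaussFun K X`. -/
def gaussVec {K : Matrix ι ι ℝ} (hK : IsUnit K.det) (X : Matrix ι ι ℝ) : Hilb ι :=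
  (memLp_gaussFun hK X).toLp _

theorem coeFn_gaussVec {K : Matrix ι ι ℝ} (hK : IsUnit K.det) (X : Matrix ι ι ℝ) :
    gaussVec hK X =ᵐ[volume] gaussFun K X := MemLp.coeFn_toLp _

/-- In the symmetric arrangement `x ± b/2` the real cross terms cancel by the parallelogram law. The
chirp `X` leaves only a phase linear in `x`. -/
theorem conj_gaussFun_mul {K X : Matrix ι ι ℝ} (hX : X.IsSymm) (x b : ι → ℝ) :
    (starRingEnd ℂ) (gaussFun K X (x - (1 / 2 : ℝ) • b)) * gaussFun K X (x + (1 / 2 : ℝ) • b) =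
      Complex.exp (-(((K⁻¹ *ᵥ b) ⬝ᵥ (K⁻¹ *ᵥ b) : ℝ) : ℂ) / 4) *
        (Complex.exp (-(Complex.I * (((X *ᵥ b) ⬝ᵥ x : ℝ) : ℂ))) *
        ((gaussConst K ^ 2 * Real.exp (-((K⁻¹ *ᵥ x) ⬝ᵥ (K⁻¹ *ᵥ x))) : ℝ) : ℂ)) := by
  have hs : b ⬝ᵥ (X *ᵥ x) = x ⬝ᵥ (X *ᵥ b) := by
    rw [dotProduct_mulVec, ← mulVec_transpose, hX.eq, dotProduct_comm]
  have hs' : (X *ᵥ b) ⬝ᵥ x = x ⬝ᵥ (X *ᵥ b) := dotProduct_comm _ _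
  have hk : (K⁻¹ *ᵥ b) ⬝ᵥ (K⁻¹ *ᵥ x) = (K⁻¹ *ᵥ x) ⬝ᵥ (K⁻¹ *ᵥ b) := dotProduct_comm _ _
  rw [gaussFun, gaussFun, map_mul, ← Complex.exp_conj, Complex.ofReal_mul, Complex.ofReal_exp]
  simp only [map_sub, map_neg, map_mul, Complex.conj_ofReal, Complex.conj_I]
  rw [mul_mul_mul_comm, ← Complex.exp_add]
  have : ∀ u v w z : ℂ, Complex.exp u * (Complex.exp v * (z * Complex.exp w)) =
      z * Complex.exp (u + v + w) := fun u v w z => by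
    rw [Complex.exp_add, Complex.exp_add]; ring
  rw [this]
  congr 1
  · push_cast; ring
  · congr 1
    simp only [mulVec_add, mulVec_sub, mulVec_smul, dotProduct_add, dotProduct_sub, add_dotProduct,
      sub_dotProduct, dotProduct_smul, smul_dotProduct, smul_eq_mul, hs, hs', hk]
    push_cast
    ring

theorem inner_eq_integral {ι : Type*} [Fintype ι] (ψ φ : Hilb ι) :
    inner ℂ ψ φ = ∫ x, (starRingEnd ℂ) (ψ x) * φ x := by
  rw [L2.inner_def]
  congr 1
  funext x
  rw [RCLike.inner_apply, mul_comm]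

theorem inner_weyl_gaussVec {K X : Matrix ι ι ℝ} (hK : IsUnit K.det) (hX : X.IsSymm)
    (ξ : Phase ι) :
    inner ℂ (gaussVec hK X) (weyl ξ (gaussVec hK X)) =
      Complex.exp (-(((Kᵀ *ᵥ (posPart ξ - X *ᵥ momPart ξ)) ⬝ᵥ
          (Kᵀ *ᵥ (posPart ξ - X *ᵥ momPart ξ)) +
        (K⁻¹ *ᵥ momPart ξ) ⬝ᵥ (K⁻¹ *ᵥ momPart ξ) : ℝ) : ℂ) / 4) := by
  set a := posPart ξ with ha
  set b := momPart ξ with hb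
  have h1 : inner ℂ (gaussVec hK X) (weyl ξ (gaussVec hK X)) =
      ∫ x, (starRingEnd ℂ) (gaussFun K X x) * weylFun ξ (gaussFun K X) x := by
    rw [inner_eq_integral]
    refine integral_congr_ae ?_
    filter_upwards [coeFn_gaussVec hK X, coeFn_weyl ξ (gaussVec hK X),
      weylFun_congr ξ (coeFn_gaussVec hK X)] with x e1 e2 e3
    rw [e1, e2, e3]
  rw [h1, ← integral_sub_right_eq_self _ ((1 / 2 : ℝ) • b)]
  have e : ∀ x, (starRingEnd ℂ) (gaussFun K X (x - (1 / 2 : ℝ) • b)) *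
      weylFun ξ (gaussFun K X) (x - (1 / 2 : ℝ) • b) =
      Complex.exp (-(((K⁻¹ *ᵥ b) ⬝ᵥ (K⁻¹ *ᵥ b) : ℝ) : ℂ) / 4) *
      (Complex.exp (Complex.I * (((a - X *ᵥ b) ⬝ᵥ x : ℝ) : ℂ)) *
        ((gaussConst K ^ 2 * Real.exp (-((K⁻¹ *ᵥ x) ⬝ᵥ (K⁻¹ *ᵥ x))) : ℝ) : ℂ)) := fun x => by
    have h2 : x - (1 / 2 : ℝ) • b + b = x + (1 / 2 : ℝ) • b := by
      ext i; simp; ring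
    rw [weylFun, ← ha, ← hb, h2, mul_left_comm, conj_gaussFun_mul hX]
    have h3 : Complex.exp (Complex.I * (((a - X *ᵥ b) ⬝ᵥ x : ℝ) : ℂ)) =
        Complex.exp (Complex.I * ((a ⬝ᵥ (x - (1 / 2 : ℝ) • b) + a ⬝ᵥ b / 2 : ℝ) : ℂ)) *
          Complex.exp (-(Complex.I * (((X *ᵥ b) ⬝ᵥ x : ℝ) : ℂ))) := by
      rw [← Complex.exp_add]
      congr 1
      simp only [sub_dotProduct, dotProduct_sub, dotProduct_smul, smul_eq_mul]
      push_cast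
      ring
    rw [h3]
    ring
  simp_rw [e]
  rw [integral_const_mul, integral_gaussian hK, ← Complex.exp_add]
  congr 1
  push_cast
  ring

theorem gaussianWith_gaussVec {K X : Matrix ι ι ℝ} (hK : IsUnit K.det) (hX : X.IsSymm)
    {C : Matrix (ι ⊕ ι) (ι ⊕ ι) ℝ} (hC : C.IsSymm)
    (h : ∀ ξ : Phase ι, ξ ⬝ᵥ (C *ᵥ ξ) = (Kᵀ *ᵥ (posPart ξ - X *ᵥ momPart ξ)) ⬝ᵥ
        (Kᵀ *ᵥ (posPart ξ - X *ᵥ momPart ξ)) + (K⁻¹ *ᵥ momPart ξ) ⬝ᵥ (K⁻¹ *ᵥ momPart ξ)) :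
    GaussianWith (gaussVec hK X) 0 C := by
  have hchar : ∀ ξ, inner ℂ (gaussVec hK X) (weyl ξ (gaussVec hK X)) =
      Complex.exp (Complex.I * ((ξ ⬝ᵥ (0 : Phase ι) : ℝ) : ℂ) -
        ((ξ ⬝ᵥ (C *ᵥ ξ) : ℝ) : ℂ) / 4) := fun ξ => by
    rw [inner_weyl_gaussVec hK hX, h]
    congr 1
    simp
    ring
  refine ⟨?_, hC, hchar⟩
  have h0 := hchar 0
  rw [weyl_zero] at h0
  have h1 : ‖gaussVec hK X‖ ^ 2 = 1 := by
    rw [@norm_sq_eq_re_inner ℂ, h0]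
    simp
  exact (pow_eq_one_iff_of_nonneg (norm_nonneg _) two_ne_zero).1 h1

/-- The orbit of an almost everywhere non-vanishing wave function under the Weyl operators is
total. -/
theorem span_weyl_eq_top {ι : Type*} [Fintype ι] {ψ : Hilb ι} (hψ : ∀ᵐ x, ψ x ≠ 0) :
    (Submodule.span ℂ (Set.range fun ξ => weyl ξ ψ)).topologicalClosure = ⊤ := by
  rw [Submodule.topologicalClosure_eq_top_iff, Submodule.eq_bot_iff]
  intro φ hφ
  have h0 : ∀ ξ, inner ℂ (weyl ξ ψ) φ = 0 := fun ξ =>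
    (Submodule.mem_orthogonal _ φ).1 hφ _ (Submodule.subset_span ⟨ξ, rfl⟩)
  have hint : Integrable fun x => (starRingEnd ℂ) (ψ x) * φ x := by
    refine (L2.integrable_inner (𝕜 := ℂ) ψ φ).congr (Filter.Eventually.of_forall fun x => ?_)
    simp only [RCLike.inner_apply]
    rw [mul_comm]
  -- Pure multiplications by characters (momentum part 0) suffice: orthogonality to them says that
  -- the Fourier transform of `conj ψ · φ` vanishes.
  have hz := ae_eq_zero_of_fourier_eq_zero hint fun a => by
    have := h0 (Sum.elim (-a) 0)
    rw [inner_eq_integral] at this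
    rw [← this]
    refine integral_congr_ae ?_
    filter_upwards [coeFn_weyl (Sum.elim (-a) 0) ψ] with x hx
    rw [hx, weylFun]
    have e1 : posPart (Sum.elim (-a) 0 : Phase ι) = -a := rfl
    have e2 : momPart (Sum.elim (-a) 0 : Phase ι) = 0 := rfl
    rw [e1, e2, map_mul, ← Complex.exp_conj]
    simp only [dotProduct_zero, add_zero, zero_div, map_mul, Complex.conj_I, neg_dotProduct,
      Complex.ofReal_neg, map_neg, Complex.conj_ofReal, neg_mul_neg]
    ring
  apply Lp.ext
  filter_upwards [hz, hψ, Lp.coeFn_zero ℂ 2 (volume : Measure (ι → ℝ))] with x h1 h2 h3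
  rw [h3]
  simp only [Pi.zero_apply, mul_eq_zero, map_eq_zero] at h1 ⊢
  exact h1.resolve_left h2

theorem span_weyl_gaussVec {K : Matrix ι ι ℝ} (hK : IsUnit K.det) (X : Matrix ι ι ℝ) :
    (Submodule.span ℂ (Set.range fun ξ => weyl ξ (gaussVec hK X))).topologicalClosure = ⊤ := by
  refine span_weyl_eq_top ?_
  filter_upwards [coeFn_gaussVec hK X] with x hx
  rw [hx]
  exact gaussFun_ne_zero hK X x

/-- Every positive symplectic matrix `S * Sᵀ` is the covariance matrix of a Gaussian vector. -/
theorem exists_gaussVec_of_symplectic {S : Matrix (ι ⊕ ι) (ι ⊕ ι) ℝ}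
    (hS : S ∈ symplecticGroup ι ℝ) :
    ∃ ψ : Hilb ι, GaussianWith ψ 0 (S * Sᵀ) ∧
      (Submodule.span ℂ (Set.range fun ξ => weyl ξ ψ)).topologicalClosure = ⊤ := by
  have hP : S * Sᵀ ∈ symplecticGroup ι ℝ := mul_mem hS (SymplecticGroup.transpose_mem hS)
  have hsymm : (S * Sᵀ).IsSymm := by rw [IsSymm, transpose_mul, transpose_transpose]
  have hpos : (S * Sᵀ).PosDef := by
    have hS' : IsUnit S := (Matrix.isUnit_iff_isUnit_det S).2 (SymplecticGroup.symplectic_det hS)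
    have := (Matrix.PosDef.one (n := ι ⊕ ι) (R := ℝ)).mul_mul_conjTranspose_same (B := S)
      (Matrix.vecMul_injective_iff_isUnit.2 hS')
    simpa using this
  set P := S * Sᵀ
  obtain ⟨A, B, B', D, hPb⟩ : ∃ A B B' D, P = fromBlocks A B B' D :=
    ⟨_, _, _, _, (fromBlocks_toBlocks P).symm⟩
  rw [hPb, IsSymm, fromBlocks_transpose, fromBlocks_inj] at hsymm
  obtain ⟨hA, hB', hB, hD⟩ := hsymm
  rw [hPb, SymplecticGroup.fromBlocks_mem_iff] at hP
  have hApos : A.PosDef := by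
    have h1 : A = P.submatrix Sum.inl Sum.inl := by rw [hPb]; rfl
    rw [h1]
    exact hpos.submatrix Sum.inl_injective
  -- With `A = K Kᵀ` and chirp `X = -A⁻¹ B`, completing the square in the position part reproduces
  -- `P`. The symplectic relations make `X` symmetric and force the last block `D = A⁻¹ + A⁻¹ B B`.
  obtain ⟨K, hKu, hAK⟩ := exists_eq_mul_transpose_of_posDef hApos
  have hK : IsUnit K.det := (Matrix.isUnit_iff_isUnit_det K).1 hKu
  have hAdet : IsUnit A.det := (Matrix.isUnit_iff_isUnit_det A).1 hApos.isUnit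
  have h1 : A * B' = B * A := by
    have := hP.1
    rwa [hA, hB'] at this
  have h2 : A * D - B * B = 1 := by
    have := hP.2.2
    rwa [hA, hB'] at this
  have hAi : (A⁻¹)ᵀ = A⁻¹ := by rw [transpose_nonsing_inv, hA]
  have h3 : B' * A⁻¹ = A⁻¹ * B := by
    rw [← Matrix.nonsing_inv_mul_cancel_left A (B' * A⁻¹) hAdet, ← Matrix.mul_assoc A, h1,
      Matrix.mul_nonsing_inv_cancel_right _ _ hAdet]
  have hD' : D = A⁻¹ + A⁻¹ * B * B := by
    rw [← Matrix.nonsing_inv_mul_cancel_left A D hAdet, sub_eq_iff_eq_add.1 h2, Matrix.mul_add,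
      Matrix.mul_one, Matrix.mul_assoc]
  have hX : (-(A⁻¹ * B)).IsSymm := by
    rw [IsSymm, transpose_neg, transpose_mul, hAi, hB, h3]
  have hmv : ∀ (M N : Matrix ι ι ℝ) (u v : ι → ℝ),
      (M *ᵥ u) ⬝ᵥ (N *ᵥ v) = u ⬝ᵥ ((Mᵀ * N) *ᵥ v) := fun M N u v => by
    rw [← mulVec_mulVec, dotProduct_mulVec u, vecMul_transpose]
  refine ⟨gaussVec hK (-(A⁻¹ * B)), gaussianWith_gaussVec hK hX
    (by rw [IsSymm, hPb, fromBlocks_transpose, hA, hB', hB, hD]) fun ξ => ?_,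
    span_weyl_gaussVec hK _⟩
  set a := posPart ξ with ha
  set b := momPart ξ with hb
  have hξ : ξ = Sum.elim a b := by ext (i | i) <;> rfl
  have hKK : (K⁻¹)ᵀ * K⁻¹ = A⁻¹ := by
    rw [hAK, Matrix.mul_inv_rev, transpose_nonsing_inv]
  rw [hPb, hξ, fromBlocks_mulVec, sumElim_dotProduct_sumElim, hmv, hmv, hKK, transpose_transpose,
    ← hAK, neg_mulVec, sub_neg_eq_add, hD']
  simp only [Sum.elim_comp_inl, Sum.elim_comp_inr]
  have e1 : (((A⁻¹ * B) *ᵥ b) ⬝ᵥ (A *ᵥ a)) = b ⬝ᵥ (B' *ᵥ a) := by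
    rw [hmv, transpose_mul, hAi, hB, Matrix.nonsing_inv_mul_cancel_right _ _ hAdet]
  have e2 : A *ᵥ ((A⁻¹ * B) *ᵥ b) = B *ᵥ b := by
    rw [mulVec_mulVec, Matrix.mul_nonsing_inv_cancel_left _ _ hAdet]
  have e3 : (((A⁻¹ * B) *ᵥ b) ⬝ᵥ (B *ᵥ b)) = b ⬝ᵥ ((A⁻¹ * B * B) *ᵥ b) := by
    rw [hmv, transpose_mul, hAi, hB, h3]
  simp only [mulVec_add, add_mulVec, dotProduct_add, add_dotProduct, e1, e2, e3]
  ring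

end GaussianVectors

/-! ### Unitaries implementing affine symplectic maps -/

section Unitaries

variable {ι : Type*} [Fintype ι]

/-- `U` implements the affine map `R ↦ S R + s` of the quadratures. -/
def Implements (U : Hilb ι ≃ₗᵢ[ℂ] Hilb ι) (S : Matrix (ι ⊕ ι) (ι ⊕ ι) ℝ) (s : Phase ι) : Prop :=
  ∀ (ξ : Phase ι) (ψ : Hilb ι), U.symm (weyl ξ (U ψ)) =
    Complex.exp (Complex.I * ((ξ ⬝ᵥ s : ℝ) : ℂ)) • weyl (Sᵀ *ᵥ ξ) ψ

/-- Gaussian states are mapped to Gaussian states. -/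
theorem GaussianWith.map {ψ : Hilb ι} {d : Phase ι} {C : Matrix (ι ⊕ ι) (ι ⊕ ι) ℝ}
    (h : GaussianWith ψ d C) {U : Hilb ι ≃ₗᵢ[ℂ] Hilb ι} {S : Matrix (ι ⊕ ι) (ι ⊕ ι) ℝ}
    {s : Phase ι} (hU : Implements U S s) :
    GaussianWith (U ψ) (S *ᵥ d + s) (S * C * Sᵀ) := by
  refine ⟨by rw [U.norm_map, h.norm_eq], ?_, fun ξ => ?_⟩
  · rw [IsSymm]; simp [Matrix.mul_assoc, h.symm.eq]
  · have h1 : inner ℂ (U ψ) (weyl ξ (U ψ)) = inner ℂ ψ (U.symm (weyl ξ (U ψ))) :=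
      U.inner_map_eq_flip _ _
    rw [h1, hU, inner_smul_right, h.char_eq, ← Complex.exp_add]
    congr 1
    have e1 : (Sᵀ *ᵥ ξ) ⬝ᵥ d = ξ ⬝ᵥ (S *ᵥ d) := by
      rw [mulVec_transpose, ← dotProduct_mulVec]
    have e2 : (Sᵀ *ᵥ ξ) ⬝ᵥ (C *ᵥ (Sᵀ *ᵥ ξ)) = ξ ⬝ᵥ ((S * C * Sᵀ) *ᵥ ξ) := by
      rw [mulVec_transpose, ← dotProduct_mulVec]
      simp only [mulVec_mulVec, ← mulVec_transpose, Matrix.mul_assoc]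
    rw [e1, e2, dotProduct_add]
    push_cast
    ring

variable [DecidableEq ι]

theorem sigma_transpose {S : Matrix (ι ⊕ ι) (ι ⊕ ι) ℝ} (hS : S ∈ symplecticGroup ι ℝ)
    (ξ η : Phase ι) : (Sᵀ *ᵥ ξ) ⬝ᵥ (J ι ℝ *ᵥ (Sᵀ *ᵥ η)) = ξ ⬝ᵥ (J ι ℝ *ᵥ η) := by
  rw [mulVec_transpose, ← dotProduct_mulVec, mulVec_mulVec, mulVec_mulVec,
    SymplecticGroup.mem_iff.1 hS]

/-- Every linear symplectic map is implemented by a unitary. -/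
theorem exists_implements_linear {S : Matrix (ι ⊕ ι) (ι ⊕ ι) ℝ} (hS : S ∈ symplecticGroup ι ℝ) :
    ∃ U : Hilb ι ≃ₗᵢ[ℂ] Hilb ι, Implements U S 0 := by
  obtain ⟨v, hv, hvt⟩ := exists_gaussVec_of_symplectic (ι := ι) (one_mem _)
  obtain ⟨w, hw, hwt⟩ := exists_gaussVec_of_symplectic hS
  have hsurj : Function.Surjective fun ξ : Phase ι => Sᵀ *ᵥ ξ := fun η => by
    have hdet : IsUnit (Sᵀ).det := by
      rw [det_transpose]; exact SymplecticGroup.symplectic_det hS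
    exact ⟨(Sᵀ)⁻¹ *ᵥ η, by simp [mulVec_mulVec, Matrix.mul_nonsing_inv _ hdet]⟩
  have hrange : Set.range (fun ξ : Phase ι => weyl (Sᵀ *ᵥ ξ) v) = Set.range fun ξ => weyl ξ v :=
    hsurj.range_comp (fun ξ => weyl ξ v)
  -- The phases in the two Gram matrices agree since `Sᵀ` preserves the symplectic form, the moduli
  -- since `|Sᵀ ζ|² = ζ·S Sᵀ ζ`.
  obtain ⟨U, hU⟩ := exists_linearIsometryEquiv_of_inner_eq (fun ξ : Phase ι => weyl (Sᵀ *ᵥ ξ) v)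
    (fun ξ => weyl ξ w) (by rw [hrange]; exact hvt) hwt (fun ξ η => by
      rw [inner_weyl_weyl, inner_weyl_weyl, sigma_transpose hS, hv.char_eq, hw.char_eq]
      congr 2
      have e2 : (Sᵀ *ᵥ (η - ξ)) ⬝ᵥ (Sᵀ *ᵥ (η - ξ)) = (η - ξ) ⬝ᵥ ((S * Sᵀ) *ᵥ (η - ξ)) := by
        conv_lhs => rw [mulVec_transpose, ← dotProduct_mulVec, ← mulVec_transpose, mulVec_mulVec]
      simp [← mulVec_sub, e2])
  refine ⟨U, fun ξ ψ => ?_⟩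
  have hset : ∀ ψ, weyl ξ (U ψ) = U (weyl (Sᵀ *ᵥ ξ) ψ) := by
    have hcl : IsClosed {ψ | weyl ξ (U ψ) = U (weyl (Sᵀ *ᵥ ξ) ψ)} :=
      isClosed_eq ((weylEquiv ξ).continuous.comp U.continuous)
        (U.continuous.comp (weylEquiv (Sᵀ *ᵥ ξ)).continuous)
    have hle : Submodule.span ℂ (Set.range fun η : Phase ι => weyl (Sᵀ *ᵥ η) v) ≤
        LinearMap.eqLocus ((weylEquiv ξ).toLinearEquiv.toLinearMap ∘ₗ U.toLinearEquiv.toLinearMap)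
          (U.toLinearEquiv.toLinearMap ∘ₗ (weylEquiv (Sᵀ *ᵥ ξ)).toLinearEquiv.toLinearMap) := by
      rw [Submodule.span_le]
      rintro _ ⟨η, rfl⟩
      change weyl ξ (U (weyl (Sᵀ *ᵥ η) v)) = U (weyl (Sᵀ *ᵥ ξ) (weyl (Sᵀ *ᵥ η) v))
      have h1 := hU η
      have h2 := hU (ξ + η)
      rw [h1, weyl_weyl, weyl_weyl, sigma_transpose hS, ← mulVec_add, map_smul, h2]
    intro ψ
    have hψ : ψ ∈ (Submodule.span ℂ
        (Set.range fun η : Phase ι => weyl (Sᵀ *ᵥ η) v)).topologicalClosure := by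
      rw [hrange, hvt]; trivial
    exact (closure_minimal hle hcl) hψ
  rw [hset, U.symm_apply_apply]
  simp

/-- Conjugating `W(ξ)` by `W(η)` only multiplies it by the phase `exp (i ξ·Jη)`; `η = -J s` gives `J
η = s`. -/
theorem implements_weyl_trans {U : Hilb ι ≃ₗᵢ[ℂ] Hilb ι} {S : Matrix (ι ⊕ ι) (ι ⊕ ι) ℝ}
    (hU : Implements U S 0) (s : Phase ι) :
    Implements (U.trans (weylEquiv (-(J ι ℝ *ᵥ s)))) S s := by
  intro ξ ψ
  set η := -(J ι ℝ *ᵥ s) with hη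
  have hJη : J ι ℝ *ᵥ η = s := by
    rw [hη, mulVec_neg, mulVec_mulVec, J_squared, neg_mulVec, one_mulVec, neg_neg]
  have hanti : η ⬝ᵥ (J ι ℝ *ᵥ ξ) = -(ξ ⬝ᵥ (J ι ℝ *ᵥ η)) := by
    rw [dotProduct_mulVec, ← mulVec_transpose, J_transpose, neg_mulVec, neg_dotProduct,
      dotProduct_comm]
  change U.symm (weyl (-η) (weyl ξ (weyl η (U ψ)))) = _
  rw [weyl_weyl ξ η, weyl_smul_right, weyl_weyl, neg_add_cancel_comm_assoc, map_smul, map_smul, hU,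
    smul_smul, smul_smul]
  congr 1
  rw [← Complex.exp_add, ← Complex.exp_add, mulVec_add, dotProduct_add, neg_dotProduct η,
    neg_dotProduct η, J_mulVec_dotProduct_self, hanti, hJη]
  congr 1
  simp
  ring

theorem exists_implements {S : Matrix (ι ⊕ ι) (ι ⊕ ι) ℝ} (hS : S ∈ symplecticGroup ι ℝ)
    (s : Phase ι) : ∃ U : Hilb ι ≃ₗᵢ[ℂ] Hilb ι, Implements U S s := by
  obtain ⟨U, hU⟩ := exists_implements_linear hS
  exact ⟨_, implements_weyl_trans hU s⟩

end Unitaries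

/-! ### Symplectic eigenvalues of a pure Gaussian state -/

section Purity

variable {ι : Type*} [Fintype ι] [DecidableEq ι]

/-- For a Gaussian state in Williamson normal form, `conj ψ(x) ψ(x + b)` is an explicit
Gaussian. -/
theorem GaussianWith.conj_mul_translate {ψ : Hilb ι} {ν : ι → ℝ} (hν : ∀ i, 0 < ν i)
    (h : GaussianWith ψ 0 (diagonal (Sum.elim ν ν))) (b : ι → ℝ) :
    ∀ᵐ x, (starRingEnd ℂ) (ψ x) * ψ (x + b) =
      ((Real.exp (-(∑ i, ν i * b i ^ 2) / 4) *
        (gaussConst (diagonal fun i => Real.sqrt (ν i)) ^ 2 *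
          Real.exp (-(∑ i, (x i + b i / 2) ^ 2 / ν i))) : ℝ) : ℂ) := by
  set K : Matrix ι ι ℝ := diagonal fun i => Real.sqrt (ν i) with hKdef
  have hK : IsUnit K.det := by
    rw [hKdef, det_diagonal, isUnit_iff_ne_zero, Finset.prod_ne_zero_iff]
    exact fun i _ => (Real.sqrt_pos.2 (hν i)).ne'
  have hKinv : K⁻¹ = diagonal fun i => (Real.sqrt (ν i))⁻¹ := by
    refine Matrix.inv_eq_right_inv ?_
    rw [hKdef, diagonal_mul_diagonal, ← diagonal_one]
    congr 1
    funext i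
    exact mul_inv_cancel₀ (Real.sqrt_pos.2 (hν i)).ne'
  have hsq : ∀ y : ι → ℝ, (K⁻¹ *ᵥ y) ⬝ᵥ (K⁻¹ *ᵥ y) = ∑ i, y i ^ 2 / ν i := fun y => by
    simp only [hKinv, dotProduct, mulVec_diagonal]
    refine Finset.sum_congr rfl fun i _ => ?_
    rw [mul_mul_mul_comm, ← mul_inv, Real.mul_self_sqrt (hν i).le]
    ring
  have hsq' : ∀ a : ι → ℝ, (Kᵀ *ᵥ a) ⬝ᵥ (Kᵀ *ᵥ a) = ∑ i, ν i * a i ^ 2 := fun a => by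
    simp only [hKdef, diagonal_transpose, dotProduct, mulVec_diagonal]
    refine Finset.sum_congr rfl fun i _ => ?_
    rw [mul_mul_mul_comm, Real.mul_self_sqrt (hν i).le]
    ring
  let g : (ι → ℝ) → ℂ := fun x =>
    ((gaussConst K ^ 2 * Real.exp (-((K⁻¹ *ᵥ x) ⬝ᵥ (K⁻¹ *ᵥ x))) : ℝ) : ℂ)
  have hg : Integrable g := (integrable_gaussian hK).ofReal
  let c : ℂ := ((Real.exp (-(∑ i, ν i * b i ^ 2) / 4) : ℝ) : ℂ)
  have hF : Integrable fun x => (starRingEnd ℂ) (ψ x) * ψ (x + b) := by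
    have := L2.integrable_inner (𝕜 := ℂ) ψ (weyl (Sum.elim 0 b) ψ)
    refine this.congr ?_
    filter_upwards [coeFn_weyl (Sum.elim 0 b) ψ] with x hx
    have e1 : posPart (Sum.elim 0 b : Phase ι) = 0 := rfl
    have e2 : momPart (Sum.elim 0 b : Phase ι) = b := rfl
    rw [RCLike.inner_apply, hx, weylFun, e1, e2, mul_comm]
    simp
  have hG : Integrable fun x => c * g (x + (1 / 2 : ℝ) • b) :=
    (hg.comp_add_right _).const_mul c
  -- For fixed `b`, the characteristic function at `(a, b)` is, up to the phase `exp (i a·b/2)`, the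
  -- Fourier transform in `a` of `conj ψ(x) ψ(x + b)`. Injectivity identifies this function.
  have hz := ae_eq_zero_of_fourier_eq_zero (hF.sub hG) fun a => by
    have hint1 : ∫ x, Complex.exp (Complex.I * ((a ⬝ᵥ x : ℝ) : ℂ)) *
        ((starRingEnd ℂ) (ψ x) * ψ (x + b)) =
        Complex.exp (-(Complex.I * ((a ⬝ᵥ b / 2 : ℝ) : ℂ))) *
          inner ℂ ψ (weyl (Sum.elim a b) ψ) := by
      rw [inner_eq_integral, ← integral_const_mul]
      refine integral_congr_ae ?_
      filter_upwards [coeFn_weyl (Sum.elim a b) ψ] with x hx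
      have e1 : posPart (Sum.elim a b : Phase ι) = a := rfl
      have e2 : momPart (Sum.elim a b : Phase ι) = b := rfl
      rw [hx, weylFun, e1, e2, Complex.ofReal_add, mul_add, Complex.exp_add, Complex.exp_neg]
      field_simp
    have hint2 : ∫ x, Complex.exp (Complex.I * ((a ⬝ᵥ x : ℝ) : ℂ)) *
        (c * g (x + (1 / 2 : ℝ) • b)) =
        Complex.exp (-(Complex.I * ((a ⬝ᵥ b / 2 : ℝ) : ℂ))) * (c *
          Complex.exp (-((∑ i, ν i * a i ^ 2 : ℝ) : ℂ) / 4)) := by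
      rw [← integral_sub_right_eq_self _ ((1 / 2 : ℝ) • b), ← hsq', ← integral_gaussian hK a,
        ← integral_const_mul, ← integral_const_mul]
      congr 1
      funext x
      rw [sub_add_cancel, dotProduct_sub, dotProduct_smul, Complex.ofReal_sub, mul_sub,
        sub_eq_add_neg, Complex.exp_add]
      have e : (1 / 2 : ℝ) • (a ⬝ᵥ b) = a ⬝ᵥ b / 2 := by rw [smul_eq_mul]; ring
      rw [e]
      simp only [g]
      ring
    simp only [Pi.sub_apply, mul_sub]
    rw [integral_sub (integrable_character_mul a hF) (integrable_character_mul a hG), hint1, hint2,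
      h.char_eq, ← mul_sub]
    have e : (Sum.elim a b ⬝ᵥ (diagonal (Sum.elim ν ν) *ᵥ Sum.elim a b) : ℝ) =
        ∑ i, ν i * a i ^ 2 + ∑ i, ν i * b i ^ 2 := by
      simp only [dotProduct, mulVec_diagonal, Fintype.sum_sum_type, Sum.elim_inl, Sum.elim_inr]
      congr 1 <;> exact Finset.sum_congr rfl fun i _ => by ring
    rw [e]
    simp only [c]
    rw [Complex.ofReal_exp, ← Complex.exp_add, dotProduct_zero]
    rw [mul_eq_zero, sub_eq_zero]
    right
    congr 1
    push_cast
    ring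
  filter_upwards [hz] with x hx
  simp only [Pi.sub_apply, Pi.zero_apply, sub_eq_zero] at hx
  rw [hx]
  simp only [c, g, hsq]
  rw [← Complex.ofReal_mul]
  congr 6
  funext i
  simp
  ring

/-- With `F_b(x) = conj ψ(x) ψ(x + b)`, the rank-one structure of a pure state gives `|F_b(x)|² =
F_0(x) F_0(x + b)`. For the explicit Gaussians with `b` the unit vector along `k`, comparing
exponents leaves `ν k / 2 = 1 / (2 ν k)`. -/
theorem GaussianWith.eq_one_of_diagonal {ψ : Hilb ι} {ν : ι → ℝ} (hν : ∀ i, 0 < ν i)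
    (h : GaussianWith ψ 0 (diagonal (Sum.elim ν ν))) (k : ι) : ν k = 1 := by
  set b : ι → ℝ := Pi.single k 1 with hb
  have h0 := h.conj_mul_translate hν 0
  have h1 := h.conj_mul_translate hν b
  set c := gaussConst (diagonal fun i => Real.sqrt (ν i)) ^ 2
  have hc : 0 < c := by
    refine pow_pos (gaussConst_pos ?_) 2
    rw [det_diagonal, isUnit_iff_ne_zero, Finset.prod_ne_zero_iff]
    exact fun i _ => (Real.sqrt_pos.2 (hν i)).ne'
  have h2 : ∀ᵐ x : ι → ℝ, (starRingEnd ℂ) (ψ (x + b)) * ψ (x + b + 0) =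
      ((Real.exp (-(∑ i, ν i * (0 : ι → ℝ) i ^ 2) / 4) *
        (c * Real.exp (-(∑ i, ((x + b) i + (0 : ι → ℝ) i / 2) ^ 2 / ν i))) : ℝ) : ℂ) :=
    (measurePreserving_add_right volume b).quasiMeasurePreserving.ae h0
  -- The three identities hold almost everywhere, so one common point `x` suffices.
  obtain ⟨x, hx0, hx1, hx2⟩ := (h0.and (h1.and h2)).exists
  have hkey : (Real.exp (-(∑ i, ν i * b i ^ 2) / 4) *
      (c * Real.exp (-(∑ i, (x i + b i / 2) ^ 2 / ν i)))) ^ 2 =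
      (c * Real.exp (-(∑ i, x i ^ 2 / ν i))) * (c * Real.exp (-(∑ i, (x i + b i) ^ 2 / ν i))) := by
    have e0 : ‖ψ x‖ ^ 2 = c * Real.exp (-(∑ i, x i ^ 2 / ν i)) := by
      have := congrArg norm hx0
      rw [add_zero, norm_mul, RCLike.norm_conj, Complex.norm_real,
        Real.norm_of_nonneg (by positivity), ← sq] at this
      simpa using this
    have e2 : ‖ψ (x + b)‖ ^ 2 = c * Real.exp (-(∑ i, (x i + b i) ^ 2 / ν i)) := by
      have := congrArg norm hx2
      rw [add_zero, norm_mul, RCLike.norm_conj, Complex.norm_real,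
        Real.norm_of_nonneg (by positivity), ← sq] at this
      simpa using this
    rw [← e0, ← e2, ← mul_pow]
    have := congrArg norm hx1
    rw [norm_mul, RCLike.norm_conj, Complex.norm_real, Real.norm_of_nonneg (by positivity)] at this
    rw [this]
  have hexp : Real.exp (2 * (-(∑ i, ν i * b i ^ 2) / 4 + -(∑ i, (x i + b i / 2) ^ 2 / ν i))) =
      Real.exp (-(∑ i, x i ^ 2 / ν i) + -(∑ i, (x i + b i) ^ 2 / ν i)) := by
    rw [two_mul, Real.exp_add, Real.exp_add, Real.exp_add]
    have hc2 : c ^ 2 ≠ 0 := by positivity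
    apply mul_left_cancel₀ hc2
    linear_combination hkey
  have hlin := Real.exp_injective hexp
  have hpar : ∑ i, x i ^ 2 / ν i + ∑ i, (x i + b i) ^ 2 / ν i =
      2 * ∑ i, (x i + b i / 2) ^ 2 / ν i + (∑ i, b i ^ 2 / ν i) / 2 := by
    rw [Finset.mul_sum, Finset.sum_div, ← Finset.sum_add_distrib, ← Finset.sum_add_distrib]
    refine Finset.sum_congr rfl fun i _ => ?_
    have := (hν i).ne'
    field_simp
    ring
  have hs1 : ∑ i, ν i * b i ^ 2 = ν k := by
    rw [Finset.sum_eq_single k] <;> simp +contextual [hb]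
  have hs2 : ∑ i, b i ^ 2 / ν i = 1 / ν k := by
    rw [Finset.sum_eq_single k] <;> simp +contextual [hb]
  rw [hs1] at hlin
  rw [hs2] at hpar
  have hfin : ν k = 1 / ν k := by linarith
  rw [eq_div_iff (hν k).ne'] at hfin
  nlinarith [hν k]

/-- The covariance matrix of a pure Gaussian state is symplectically congruent to the identity. -/
theorem GaussianWith.exists_mul_mul_transpose_eq_one {ψ : Hilb ι} {d : Phase ι}
    {C : Matrix (ι ⊕ ι) (ι ⊕ ι) ℝ} (h : GaussianWith ψ d C) :
    ∃ S ∈ symplecticGroup ι ℝ, S * C * Sᵀ = 1 := by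
  obtain ⟨ν, hν, S, hS, hSC⟩ := exists_isSymplecticSpectrum h.posDef
  -- This displacement cancels the transformed mean `S d`, bringing the state to centred normal
  -- form.
  obtain ⟨U, hU⟩ := exists_implements hS (-(S *ᵥ d))
  have h1 := h.map hU
  rw [add_neg_cancel, hSC] at h1
  have h2 : ν = fun _ => 1 := funext (h1.eq_one_of_diagonal hν)
  refine ⟨S, hS, ?_⟩
  rw [hSC, h2, ← diagonal_one]
  congr 1
  ext (i | i) <;> rfl

end Purity

/-! ### Product vectors and local unitaries -/

section Tensor

variable {ι κ : Type*} [Fintype ι] [Fintype κ]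

theorem coeFn_tensor (f : Hilb ι) (g : Hilb κ) : tensor f g =ᵐ[volume] tensorFun f g :=
  MemLp.coeFn_toLp _

theorem quasiMeasurePreserving_comp_inl :
    Measure.QuasiMeasurePreserving (fun (x : ι ⊕ κ → ℝ) i => x (Sum.inl i)) volume volume :=
  Measure.quasiMeasurePreserving_fst.comp
    (volume_measurePreserving_sumPiEquivProdPi fun _ : ι ⊕ κ => ℝ).quasiMeasurePreserving

theorem quasiMeasurePreserving_comp_inr :
    Measure.QuasiMeasurePreserving (fun (x : ι ⊕ κ → ℝ) j => x (Sum.inr j)) volume volume :=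
  Measure.quasiMeasurePreserving_snd.comp
    (volume_measurePreserving_sumPiEquivProdPi fun _ : ι ⊕ κ => ℝ).quasiMeasurePreserving

theorem tensorFun_congr {f f' : (ι → ℝ) → ℂ} {g g' : (κ → ℝ) → ℂ} (hf : f =ᵐ[volume] f')
    (hg : g =ᵐ[volume] g') : tensorFun f g =ᵐ[volume] tensorFun f' g' := by
  filter_upwards [quasiMeasurePreserving_comp_inl.ae_eq_comp hf,
    quasiMeasurePreserving_comp_inr.ae_eq_comp hg] with x h1 h2
  simp only [Function.comp_apply] at h1 h2
  rw [tensorFun, tensorFun, h1, h2]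

theorem tensor_smul_smul (a b : ℂ) (f : Hilb ι) (g : Hilb κ) :
    tensor (a • f) (b • g) = (a * b) • tensor f g := by
  apply Lp.ext
  filter_upwards [coeFn_tensor (a • f) (b • g), coeFn_tensor f g,
    Lp.coeFn_smul (a * b) (tensor f g),
    tensorFun_congr (Lp.coeFn_smul a f) (Lp.coeFn_smul b g)] with x h1 h2 h3 h4
  rw [h1, h4, h3, Pi.smul_apply, h2]
  simp only [tensorFun, Pi.smul_apply, smul_eq_mul]
  ring

theorem inner_tensor (f f' : Hilb ι) (g g' : Hilb κ) :
    inner ℂ (tensor f g) (tensor f' g') = inner ℂ f f' * inner ℂ g g' := by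
  rw [inner_eq_integral, inner_eq_integral, inner_eq_integral, ← integral_prod_mul]
  have hmp := volume_measurePreserving_sumPiEquivProdPi (fun _ : ι ⊕ κ => ℝ)
  have h := hmp.integral_comp' (fun z : (ι → ℝ) × (κ → ℝ) =>
    ((starRingEnd ℂ) (f z.1) * f' z.1) * ((starRingEnd ℂ) (g z.2) * g' z.2))
  refine Eq.trans ?_ h
  refine integral_congr_ae ?_
  filter_upwards [coeFn_tensor f g, coeFn_tensor f' g'] with x h1 h2
  rw [h1, h2, tensorFun, tensorFun, map_mul]
  simp only [MeasurableEquiv.coe_sumPiEquivProdPi, Equiv.sumPiEquivProdPi_apply]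
  ring

/-- The component of a phase space vector in the first subsystem. -/
def fstPhase {ι κ : Type*} (ξ : Phase (ι ⊕ κ)) : Phase ι := fun k => ξ (Sum.map Sum.inl Sum.inl k)

/-- The component of a phase space vector in the second subsystem. -/
def sndPhase {ι κ : Type*} (ξ : Phase (ι ⊕ κ)) : Phase κ := fun k => ξ (Sum.map Sum.inr Sum.inr k)

theorem weyl_tensor (ξ : Phase (ι ⊕ κ)) (f : Hilb ι) (g : Hilb κ) :
    weyl ξ (tensor f g) = tensor (weyl (fstPhase ξ) f) (weyl (sndPhase ξ) g) := by
  apply Lp.ext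
  filter_upwards [coeFn_weyl ξ (tensor f g), weylFun_congr ξ (coeFn_tensor f g),
    coeFn_tensor (weyl (fstPhase ξ) f) (weyl (sndPhase ξ) g),
    tensorFun_congr (coeFn_weyl (fstPhase ξ) f) (coeFn_weyl (sndPhase ξ) g)] with x h1 h2 h3 h4
  rw [h1, h2, h3, h4]
  simp only [weylFun, tensorFun]
  rw [mul_mul_mul_comm, ← Complex.exp_add, ← mul_add, ← Complex.ofReal_add]
  congr 1
  congr 3
  simp only [dotProduct, Fintype.sum_sum_type, posPart, momPart, fstPhase, sndPhase, Sum.map_inl,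
    Sum.map_inr]
  ring

variable [DecidableEq ι] [DecidableEq κ]

/-- Weyl operators preserve product vectors, so the total Weyl orbit of a nowhere vanishing product
Gaussian already consists of product vectors. -/
theorem span_tensor_eq_top : (Submodule.span ℂ
    (Set.range fun p : Hilb ι × Hilb κ => tensor p.1 p.2)).topologicalClosure = ⊤ := by
  have h1 : IsUnit (1 : Matrix ι ι ℝ).det := by simp
  have h2 : IsUnit (1 : Matrix κ κ ℝ).det := by simp
  have h := span_weyl_eq_top (ψ := tensor (gaussVec h1 0) (gaussVec h2 0)) (by
    filter_upwards [coeFn_tensor (gaussVec h1 0) (gaussVec h2 0),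
      tensorFun_congr (coeFn_gaussVec h1 0) (coeFn_gaussVec h2 0)] with x e1 e2
    rw [e1, e2]
    exact mul_ne_zero (gaussFun_ne_zero h1 _ _) (gaussFun_ne_zero h2 _ _))
  rw [eq_top_iff, ← h]
  refine Submodule.topologicalClosure_mono (Submodule.span_mono ?_)
  rintro _ ⟨ξ, rfl⟩
  exact ⟨(_, _), (weyl_tensor ξ _ _).symm⟩

/-- The tensor product of two unitaries. -/
theorem exists_tensor_unitary (U₁ : Hilb ι ≃ₗᵢ[ℂ] Hilb ι) (U₂ : Hilb κ ≃ₗᵢ[ℂ] Hilb κ) :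
    ∃ V : Hilb (ι ⊕ κ) ≃ₗᵢ[ℂ] Hilb (ι ⊕ κ),
      ∀ f g, V (tensor f g) = tensor (U₁ f) (U₂ g) := by
  have hsurj : Function.Surjective fun p : Hilb ι × Hilb κ => (U₁ p.1, U₂ p.2) :=
    U₁.surjective.prodMap U₂.surjective
  have hrange : Set.range (fun p : Hilb ι × Hilb κ => tensor (U₁ p.1) (U₂ p.2)) =
      Set.range fun p : Hilb ι × Hilb κ => tensor p.1 p.2 :=
    hsurj.range_comp fun p : Hilb ι × Hilb κ => tensor p.1 p.2
  obtain ⟨V, hV⟩ := exists_linearIsometryEquiv_of_inner_eq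
    (fun p : Hilb ι × Hilb κ => tensor p.1 p.2) (fun p => tensor (U₁ p.1) (U₂ p.2))
    span_tensor_eq_top (by rw [hrange]; exact span_tensor_eq_top) (fun p q => by
      rw [inner_tensor, inner_tensor, U₁.inner_map_map, U₂.inner_map_map])
  exact ⟨V, fun f g => hV (f, g)⟩

/-- The direct sum of two phase space matrices. -/
def sumMatrix {ι κ : Type*} (S₁ : Matrix (ι ⊕ ι) (ι ⊕ ι) ℝ) (S₂ : Matrix (κ ⊕ κ) (κ ⊕ κ) ℝ) :
    Matrix ((ι ⊕ κ) ⊕ (ι ⊕ κ)) ((ι ⊕ κ) ⊕ (ι ⊕ κ)) ℝ :=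
  (fromBlocks S₁ 0 0 S₂).submatrix (Equiv.sumSumSumComm ι ι κ κ).symm
    (Equiv.sumSumSumComm ι ι κ κ).symm

/-- The direct sum of two phase space vectors. -/
def sumVec {ι κ : Type*} (s₁ : Phase ι) (s₂ : Phase κ) : Phase (ι ⊕ κ) :=
  Sum.elim s₁ s₂ ∘ (Equiv.sumSumSumComm ι ι κ κ).symm

theorem comp_sumSumSumComm {ι κ : Type*} (ξ : Phase (ι ⊕ κ)) :
    ξ ∘ Equiv.sumSumSumComm ι ι κ κ = Sum.elim (fstPhase ξ) (sndPhase ξ) := by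
  ext ((i | i) | (i | i)) <;> rfl

theorem sumVec_fst_snd {ι κ : Type*} (ξ : Phase (ι ⊕ κ)) :
    sumVec (fstPhase ξ) (sndPhase ξ) = ξ := by
  ext ((i | i) | (i | i)) <;> rfl

theorem fstPhase_sumVec {ι κ : Type*} (s₁ : Phase ι) (s₂ : Phase κ) :
    fstPhase (sumVec s₁ s₂) = s₁ := by
  ext (i | i) <;> rfl

theorem sndPhase_sumVec {ι κ : Type*} (s₁ : Phase ι) (s₂ : Phase κ) :
    sndPhase (sumVec s₁ s₂) = s₂ := by
  ext (i | i) <;> rfl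

theorem dotProduct_sumVec {ι κ : Type*} [Fintype ι] [Fintype κ] (ξ : Phase (ι ⊕ κ)) (s₁ : Phase ι)
    (s₂ : Phase κ) : ξ ⬝ᵥ sumVec s₁ s₂ = fstPhase ξ ⬝ᵥ s₁ + sndPhase ξ ⬝ᵥ s₂ := by
  rw [sumVec, ← comp_equiv_dotProduct_comp_equiv _ _ (Equiv.sumSumSumComm ι ι κ κ),
    comp_sumSumSumComm]
  rw [Function.comp_assoc, Equiv.symm_comp_self, Function.comp_id, sumElim_dotProduct_sumElim]

theorem sumMatrix_transpose_mulVec {ι κ : Type*} [Fintype ι] [Fintype κ]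
    (S₁ : Matrix (ι ⊕ ι) (ι ⊕ ι) ℝ) (S₂ : Matrix (κ ⊕ κ) (κ ⊕ κ) ℝ) (ξ : Phase (ι ⊕ κ)) :
    (sumMatrix S₁ S₂)ᵀ *ᵥ ξ = sumVec (S₁ᵀ *ᵥ fstPhase ξ) (S₂ᵀ *ᵥ sndPhase ξ) := by
  rw [sumMatrix, transpose_submatrix, submatrix_mulVec_equiv, Equiv.symm_symm, comp_sumSumSumComm,
    fromBlocks_transpose, fromBlocks_mulVec, sumVec]
  simp

/-- Local unitaries implement block diagonal maps of the quadratures. -/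
theorem implements_of_tensor {U₁ : Hilb ι ≃ₗᵢ[ℂ] Hilb ι} {U₂ : Hilb κ ≃ₗᵢ[ℂ] Hilb κ}
    {V : Hilb (ι ⊕ κ) ≃ₗᵢ[ℂ] Hilb (ι ⊕ κ)}
    (hV : ∀ f g, V (tensor f g) = tensor (U₁ f) (U₂ g))
    {S₁ : Matrix (ι ⊕ ι) (ι ⊕ ι) ℝ} {S₂ : Matrix (κ ⊕ κ) (κ ⊕ κ) ℝ} {s₁ : Phase ι} {s₂ : Phase κ}
    (h₁ : Implements U₁ S₁ s₁) (h₂ : Implements U₂ S₂ s₂) :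
    Implements V (sumMatrix S₁ S₂) (sumVec s₁ s₂) := by
  intro ξ ψ
  set η := (sumMatrix S₁ S₂)ᵀ *ᵥ ξ with hη
  set c := Complex.exp (Complex.I * ((ξ ⬝ᵥ sumVec s₁ s₂ : ℝ) : ℂ)) with hc
  have hcl : IsClosed {ψ | V.symm (weyl ξ (V ψ)) = c • weyl η ψ} :=
    isClosed_eq (V.symm.continuous.comp ((weylEquiv ξ).continuous.comp V.continuous))
      ((weylEquiv η).continuous.const_smul c)
  have hle : Submodule.span ℂ (Set.range fun p : Hilb ι × Hilb κ => tensor p.1 p.2) ≤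
      LinearMap.eqLocus (V.symm.toLinearEquiv.toLinearMap ∘ₗ
          (weylEquiv ξ).toLinearEquiv.toLinearMap ∘ₗ V.toLinearEquiv.toLinearMap)
        (c • (weylEquiv η).toLinearEquiv.toLinearMap) := by
    rw [Submodule.span_le]
    rintro _ ⟨⟨f, g⟩, rfl⟩
    change V.symm (weyl ξ (V (tensor f g))) = c • weyl η (tensor f g)
    have e1 := congrArg U₁ (h₁ (fstPhase ξ) f)
    have e2 := congrArg U₂ (h₂ (sndPhase ξ) g)
    rw [U₁.apply_symm_apply, map_smul] at e1
    rw [U₂.apply_symm_apply, map_smul] at e2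
    rw [LinearIsometryEquiv.symm_apply_eq, map_smul, hV, weyl_tensor, weyl_tensor, hV, e1, e2,
      tensor_smul_smul, hη, sumMatrix_transpose_mulVec, fstPhase_sumVec, sndPhase_sumVec, hc,
      dotProduct_sumVec, ← Complex.exp_add, ← mul_add, ← Complex.ofReal_add]
  have hψ : ψ ∈ (Submodule.span ℂ
      (Set.range fun p : Hilb ι × Hilb κ => tensor p.1 p.2)).topologicalClosure := by
    rw [span_tensor_eq_top]; trivial
  exact (closure_minimal hle hcl) hψ

theorem trace_sumMatrix {ι κ : Type*} [Fintype ι] [Fintype κ]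
    (S₁ : Matrix (ι ⊕ ι) (ι ⊕ ι) ℝ) (S₂ : Matrix (κ ⊕ κ) (κ ⊕ κ) ℝ)
    (C : Matrix ((ι ⊕ κ) ⊕ (ι ⊕ κ)) ((ι ⊕ κ) ⊕ (ι ⊕ κ)) ℝ) :
    (sumMatrix S₁ S₂ * C * (sumMatrix S₁ S₂)ᵀ).trace =
      (S₁ * reducedCov C * S₁ᵀ).trace + (S₂ * reducedCov' C * S₂ᵀ).trace := by
  set e := Equiv.sumSumSumComm ι ι κ κ
  have hC : C = (fromBlocks (reducedCov C)
      (C.submatrix (Sum.map Sum.inl Sum.inl) (Sum.map Sum.inr Sum.inr))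
      (C.submatrix (Sum.map Sum.inr Sum.inr) (Sum.map Sum.inl Sum.inl))
      (reducedCov' C)).submatrix e.symm e.symm := by
    ext ((i | i) | (i | i)) ((j | j) | (j | j)) <;> rfl
  conv_lhs => rw [hC]
  rw [sumMatrix, transpose_submatrix, submatrix_mul_equiv, submatrix_mul_equiv,
    fromBlocks_transpose, fromBlocks_multiply, fromBlocks_multiply]
  have htr : ∀ M : Matrix ((ι ⊕ ι) ⊕ (κ ⊕ κ)) ((ι ⊕ ι) ⊕ (κ ⊕ κ)) ℝ,
      (M.submatrix e.symm e.symm).trace = M.trace := fun M =>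
    e.symm.sum_comp fun i => M i i
  rw [htr, Matrix.trace, Fintype.sum_sum_type]
  simp [Matrix.trace]

end Tensor

/-! ### Minimal energies and the ergotropic gap -/

section Ergotropy

variable {ι κ : Type*} [Fintype ι] [DecidableEq ι] [Fintype κ] [DecidableEq κ]

theorem iInf_energy_eq {ψ : Hilb ι} {p : (Hilb ι ≃ₗᵢ[ℂ] Hilb ι) → Prop}
    {U : Hilb ι ≃ₗᵢ[ℂ] Hilb ι} (hU : p U) (h : ∀ V, p V → energy (U ψ) ≤ energy (V ψ)) :
    ⨅ (V : Hilb ι ≃ₗᵢ[ℂ] Hilb ι) (_ : p V), energy (V ψ) = energy (U ψ) :=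
  le_antisymm (iInf₂_le U hU) (le_iInf₂ h)

/-- The minimum of the energy over all Gaussian unitaries. -/
theorem GaussianWith.exists_global_minimizer {ψ : Hilb ι} {d : Phase ι}
    {C : Matrix (ι ⊕ ι) (ι ⊕ ι) ℝ} (h : GaussianWith ψ d C) {ν : ι → ℝ}
    (hν : IsSymplecticSpectrum C ν) :
    ∃ U : Hilb ι ≃ₗᵢ[ℂ] Hilb ι, IsGaussianUnitary U ∧
      energy (U ψ) = ENNReal.ofReal ((∑ i, ν i) / 2) ∧
      ∀ V : Hilb ι ≃ₗᵢ[ℂ] Hilb ι, IsGaussianUnitary V → energy (U ψ) ≤ energy (V ψ) := by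
  have hν' := hν
  obtain ⟨-, S, hS, hSC⟩ := hν'
  obtain ⟨U, hU⟩ := exists_implements hS (-(S *ᵥ d))
  have hUψ : energy (U ψ) = ENNReal.ofReal ((∑ i, ν i) / 2) := by
    rw [(h.map hU).energy_eq, add_neg_cancel, hSC]
    congr 1
    simp [trace_diagonal]
    ring
  refine ⟨U, ⟨S, hS, _, hU⟩, hUψ, ?_⟩
  rintro V ⟨T, hT, t, hV⟩
  rw [hUψ, (h.map hV).energy_eq]
  refine ENNReal.ofReal_le_ofReal ?_
  have h1 := two_mul_sum_le_trace hν hT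
  have h2 : 0 ≤ (T *ᵥ d + t) ⬝ᵥ (T *ᵥ d + t) := Finset.sum_nonneg fun _ _ => mul_self_nonneg _
  linarith

/-- The minimum of the energy over all local Gaussian unitaries. -/
theorem GaussianWith.exists_local_minimizer {ψ : Hilb (ι ⊕ κ)} {d : Phase (ι ⊕ κ)}
    {C : Matrix ((ι ⊕ κ) ⊕ (ι ⊕ κ)) ((ι ⊕ κ) ⊕ (ι ⊕ κ)) ℝ} (h : GaussianWith ψ d C)
    {ν : ι → ℝ} {μ : κ → ℝ} (hν : IsSymplecticSpectrum (reducedCov C) ν)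
    (hμ : IsSymplecticSpectrum (reducedCov' C) μ) :
    ∃ U : Hilb (ι ⊕ κ) ≃ₗᵢ[ℂ] Hilb (ι ⊕ κ), IsLocalGaussianUnitary U ∧
      energy (U ψ) = ENNReal.ofReal ((∑ i, ν i + ∑ j, μ j) / 2) ∧
      ∀ V : Hilb (ι ⊕ κ) ≃ₗᵢ[ℂ] Hilb (ι ⊕ κ),
        IsLocalGaussianUnitary V → energy (U ψ) ≤ energy (V ψ) := by
  have hν' := hν
  have hμ' := hμ
  obtain ⟨-, S₁, hS₁, hSC₁⟩ := hν'
  obtain ⟨-, S₂, hS₂, hSC₂⟩ := hμ'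
  -- Every phase space vector splits into its two local components, so local displacements suffice
  -- to remove the whole mean, even though the two systems are correlated.
  set s := -(sumMatrix S₁ S₂ *ᵥ d) with hs
  obtain ⟨U₁, hU₁⟩ := exists_implements hS₁ (fstPhase s)
  obtain ⟨U₂, hU₂⟩ := exists_implements hS₂ (sndPhase s)
  obtain ⟨U, hU⟩ := exists_tensor_unitary U₁ U₂
  have hUψ : energy (U ψ) = ENNReal.ofReal ((∑ i, ν i + ∑ j, μ j) / 2) := by
    rw [(h.map (implements_of_tensor hU hU₁ hU₂)).energy_eq, sumVec_fst_snd, hs, add_neg_cancel,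
      trace_sumMatrix, hSC₁, hSC₂]
    congr 1
    simp [trace_diagonal]
    ring
  refine ⟨U, ⟨U₁, U₂, ⟨S₁, hS₁, _, hU₁⟩, ⟨S₂, hS₂, _, hU₂⟩, hU⟩, hUψ, ?_⟩
  rintro V ⟨V₁, V₂, ⟨T₁, hT₁, t₁, hV₁⟩, ⟨T₂, hT₂, t₂, hV₂⟩, hV⟩
  rw [hUψ, (h.map (implements_of_tensor hV hV₁ hV₂)).energy_eq, trace_sumMatrix]
  refine ENNReal.ofReal_le_ofReal ?_
  have h1 := two_mul_sum_le_trace hν hT₁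
  have h2 := two_mul_sum_le_trace hμ hT₂
  have h3 : 0 ≤ (sumMatrix T₁ T₂ *ᵥ d + sumVec t₁ t₂) ⬝ᵥ (sumMatrix T₁ T₂ *ᵥ d + sumVec t₁ t₂) :=
    Finset.sum_nonneg fun _ _ => mul_self_nonneg _
  linarith

theorem GaussianWith.posDef_reducedCov {ψ : Hilb (ι ⊕ κ)} {d : Phase (ι ⊕ κ)}
    {C : Matrix ((ι ⊕ κ) ⊕ (ι ⊕ κ)) ((ι ⊕ κ) ⊕ (ι ⊕ κ)) ℝ} (h : GaussianWith ψ d C) :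
    (reducedCov C).PosDef :=
  h.posDef.submatrix (Sum.map_injective.2 ⟨Sum.inl_injective, Sum.inl_injective⟩)

theorem GaussianWith.posDef_reducedCov' {ψ : Hilb (ι ⊕ κ)} {d : Phase (ι ⊕ κ)}
    {C : Matrix ((ι ⊕ κ) ⊕ (ι ⊕ κ)) ((ι ⊕ κ) ⊕ (ι ⊕ κ)) ℝ} (h : GaussianWith ψ d C) :
    (reducedCov' C).PosDef :=
  h.posDef.submatrix (Sum.map_injective.2 ⟨Sum.inr_injective, Sum.inr_injective⟩)

theorem GaussianWith.isSymplecticSpectrum_one {ψ : Hilb ι} {d : Phase ι}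
    {C : Matrix (ι ⊕ ι) (ι ⊕ ι) ℝ} (h : GaussianWith ψ d C) :
    IsSymplecticSpectrum C fun _ => 1 := by
  obtain ⟨S, hS, hSC⟩ := h.exists_mul_mul_transpose_eq_one
  refine ⟨fun _ => one_pos, S, hS, ?_⟩
  rw [hSC, ← diagonal_one]
  congr 1
  ext (i | i) <;> rfl

/-- The covariance matrix of a pure Gaussian state is symplectic. -/
theorem GaussianWith.mem_symplecticGroup {ψ : Hilb ι} {d : Phase ι}
    {C : Matrix (ι ⊕ ι) (ι ⊕ ι) ℝ} (h : GaussianWith ψ d C) : C ∈ symplecticGroup ι ℝ := by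
  obtain ⟨S, hS, hSC⟩ := h.exists_mul_mul_transpose_eq_one
  have hdet := SymplecticGroup.symplectic_det hS
  have hdet' : IsUnit (Sᵀ).det := by rwa [det_transpose]
  have hSi : S⁻¹ ∈ symplecticGroup ι ℝ := by
    have := (⟨S, hS⟩⁻¹ : symplecticGroup ι ℝ).2
    rwa [SymplecticGroup.coe_inv'] at this
  have hC : C = S⁻¹ * (S⁻¹)ᵀ := by
    rw [transpose_nonsing_inv, ← Matrix.mul_one S⁻¹, ← hSC, Matrix.mul_assoc, Matrix.mul_assoc,
      Matrix.mul_assoc, Matrix.mul_nonsing_inv _ hdet', Matrix.mul_one,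
      Matrix.nonsing_inv_mul_cancel_left _ _ hdet]
  rw [hC]
  exact mul_mem hSi (SymplecticGroup.transpose_mem hSi)

/-- The initial energy cancels. The global minimum is half the number of modes, the local one `(∑ ν
+ ∑ μ) / 2`; their difference is the mean of two equal excesses. -/
theorem GaussianWith.ergotropicGap_eq {ψ : Hilb (ι ⊕ κ)} {d : Phase (ι ⊕ κ)}
    {C : Matrix ((ι ⊕ κ) ⊕ (ι ⊕ κ)) ((ι ⊕ κ) ⊕ (ι ⊕ κ)) ℝ} (h : GaussianWith ψ d C)
    {ν : ι → ℝ} (hν : IsSymplecticSpectrum (reducedCov C) ν) :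
    ergotropicGap ψ = ∑ i, (ν i - 1) := by
  obtain ⟨μ, hμ⟩ := exists_isSymplecticSpectrum h.posDef_reducedCov'
  obtain ⟨U, hU, hUe, hUm⟩ := h.exists_global_minimizer h.isSymplecticSpectrum_one
  obtain ⟨V, hV, hVe, hVm⟩ := h.exists_local_minimizer hν hμ
  have hsum := sum_sub_one_eq_of_mem_symplecticGroup h.symm h.mem_symplecticGroup hν hμ
  have hν0 : 0 ≤ ∑ i, ν i := Finset.sum_nonneg fun i _ => (hν.1 i).le
  have hμ0 : 0 ≤ ∑ j, μ j := Finset.sum_nonneg fun j _ => (hμ.1 j).le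
  rw [ergotropicGap, globalErgotropy, localErgotropy, iInf_energy_eq hU hUm, iInf_energy_eq hV hVm,
    hUe, hVe, ENNReal.toReal_ofReal (by positivity), ENNReal.toReal_ofReal (by positivity)]
  simp only [Finset.sum_sub_distrib, Finset.sum_const, Finset.card_univ, nsmul_eq_mul, mul_one,
    Fintype.card_sum, Nat.cast_add] at hsum ⊢
  linarith

end Ergotropy

end CV

end

theorem lemma1 (m₁ m₂ : ℕ) (hm : m₁ ≤ m₂)
    (ψ : CV.Hilb (Fin m₁ ⊕ Fin m₂)) (hψ : CV.IsPureGaussian ψ) :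
    -- the energy is finite and both minima in the ergotropies are attained
    CV.energy ψ ≠ ⊤ ∧
    (∃ U : CV.Hilb (Fin m₁ ⊕ Fin m₂) ≃ₗᵢ[ℂ] CV.Hilb (Fin m₁ ⊕ Fin m₂),
      CV.IsGaussianUnitary U ∧
        ∀ V : CV.Hilb (Fin m₁ ⊕ Fin m₂) ≃ₗᵢ[ℂ] CV.Hilb (Fin m₁ ⊕ Fin m₂),
          CV.IsGaussianUnitary V → CV.energy (U ψ) ≤ CV.energy (V ψ)) ∧
    (∃ U : CV.Hilb (Fin m₁ ⊕ Fin m₂) ≃ₗᵢ[ℂ] CV.Hilb (Fin m₁ ⊕ Fin m₂),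
      CV.IsLocalGaussianUnitary U ∧
        ∀ V : CV.Hilb (Fin m₁ ⊕ Fin m₂) ≃ₗᵢ[ℂ] CV.Hilb (Fin m₁ ⊕ Fin m₂),
          CV.IsLocalGaussianUnitary V → CV.energy (U ψ) ≤ CV.energy (V ψ)) ∧
    -- the symplectic eigenvalues exist, and they determine the gap
    (∃ ν : Fin m₁ → ℝ, CV.IsSymplecticSpectrum (CV.reducedCov (CV.covMatrix ψ)) ν) ∧
    ∀ ν : Fin m₁ → ℝ, CV.IsSymplecticSpectrum (CV.reducedCov (CV.covMatrix ψ)) ν →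
      CV.ergotropicGap ψ = ∑ i, (ν i - 1) := by
  obtain ⟨d, C, h⟩ := hψ.exists_gaussianWith
  obtain ⟨μ, hμ⟩ := CV.exists_isSymplecticSpectrum h.posDef_reducedCov'
  obtain ⟨ν, hν⟩ := CV.exists_isSymplecticSpectrum h.posDef_reducedCov
  obtain ⟨U, hU, -, hUm⟩ := h.exists_global_minimizer h.isSymplecticSpectrum_one
  obtain ⟨V, hV, -, hVm⟩ := h.exists_local_minimizer hν hμ
  rw [h.covMatrix_eq]
  exact ⟨by rw [h.energy_eq]; exact ENNReal.ofReal_ne_top, ⟨U, hU, hUm⟩, ⟨V, hV, hVm⟩, ⟨ν, hν⟩,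
    fun ν hν => h.ergotropicGap_eq hν⟩
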